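/- **Setting.** Fix a sample size $m\ge 1$, an integer $\sigma\ge 1$, integers $a_k,b_k$ with $a_k+b_k=\sigma$ for $0\le k\le m$, and initial numbers $W_0,B_0\in\mathbb{N}_0$ of white and black balls with $T_0:=W_0+B_0\ge m$; put $T_n=T_0+\sigma n$. At each step a sample of $m$ balls is drawn and put back. If it contains $k$ white and $m-k$ black balls, then $a_{m-k}$ white and $b_{m-k}$ black balls are added. Given that the urn contains $w$ white and $b$ black balls, the probability of a sample with $k$ white balls is $\binom wk\binom b{m-k}/\binom{w+b}m$ in model $\mathcal M$ (drawing without replacement) and $\binom mk w^kb^{m-k}/(w+b)^m$ in model $\mathcal R$ (with replacement). $W_n$ is the number of white balls after $n$ draws, and the urn is tenable: the process never breaks off, i.e. the numbers of white and black balls always stay non-negative. The urn is affine: the conditional mean of $W_{n+1}$, as a function of the content of the urn after $n$ draws ($w$ white balls, $0\le w\le T_n$), is affine in $w$; equivalently $a_k=(m-k)(a_{m-1}-a_m)+a_m$ for $0\le k\le m$. Its index is $\Lambda=\frac m\sigma(a_{m-1}-a_m)$, and the urn is a large-index urn: $a_m\ne 0$ and $\frac12<\Lambda<1$. Let $\tilde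 W_n=W_n-\frac{n\,a_m}{1-\Lambda}$. **Coefficients.** For $n\ge1$ and $0\le r\le s$ let $$f_{n,s,r}=\sum_{j=s-r}^{s}\binom sj\Lambda^j\sum_{\ell=j-(s-r)}^{j}\binom{\ell}{j-(s-r)}\Big(\frac{a_m(n-1)}{1-\Lambda}\Big)^{\ell-j+s-r}\sum_{i=\ell}^{j}\binom ji\frac{\sigma^i a_m^{j-i}}{m^i(\Lambda-1)^{j-i}}\,p_{n;(i,\ell)},$$ $$p_{n;(i,\ell)}=\sum_{h=\ell}^{\min\{i,m\}}(-1)^{h-\ell}\begin{bmatrix}h\\ \ell\end{bmatrix}\begin{Bmatrix}i\\ h\end{Bmatrix}\frac{\binom mh}{\binom{T_{n-1}}h}\ \ (\mathcal M),\qquad p_{n;(i,\ell)}=\begin{Bmatrix}i\\ \ell\end{Bmatrix}\frac{m(m-1)\cdots(m-\ell+1)}{T_{n-1}^{\ell}}\ \ (\mathcal R),$$ with unsigned Stirling numbers of the first and Stirling numbers of the second kind, and let $f_{0,s,r}=1$. For heights $h_1,\dots,h_r\ge1$ let $H_g=h_1+\dots+h_g$ ($0\le g\le r$), and for $s\ge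 1$ let $$\varphi_{n,s,s}=\prod_{j=1}^n f_{j,s,s},$$ $$\varphi_{n,s,k}=\sum_{r=1}^{s-k}\ \sum_{\substack{h_1+\dots+h_r=s-k\\h_\nu\ge1}}\ \sum_{1\le i_r<\dots<i_1\le n}\ \prod_{g=1}^{r+1}\Big(f_{i_g,s-H_{g-1},s-H_g}\prod_{j=i_g+1}^{i_{g-1}-1}f_{j,s-H_{g-1},s-H_{g-1}}\Big)\qquad(1\le k\le s-1),$$ where $i_0=n+1$ and $i_{r+1}=0$ (so that the first factor for $g=r+1$ is $1$), and $$\varphi_{n,s,0}=\sum_{q=1}^{n}\sum_{\ell=1}^{s}\sum_{r=0}^{s-\ell}\ \sum_{\substack{h_1+\dots+h_r=s-\ell\\h_\nu\ge1}}\ \sum_{q+1\le i_r<\dots<i_1\le n}\ \prod_{g=1}^{r+1}\Big(f_{i_g,s-H_{g-1},s-H_g}\prod_{j=i_g+1}^{i_{g-1}-1}f_{j,s-H_{g-1},s-H_{g-1}}\Big),$$ where $i_0=n+1$, $i_{r+1}=q$ and $H_{r+1}=s$ (for $r=0$, which contributes only for $\ell=s$, there is exactly one, empty, choice of heights and of times).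 Further let $\tilde\varphi_{s,s}=1$, $$\tilde\varphi_{s,k}=\sum_{r=1}^{s-k}\ \sum_{\substack{h_1+\dots+h_r=s-k\\h_\nu\ge1}}\ \sum_{1\le i_r<\dots<i_1<\infty}\ f_{i_1,s,s-H_1}\frac{\prod_{g=2}^{r+1}\big(f_{i_g,s-H_{g-1},s-H_g}\prod_{j=i_g+1}^{i_{g-1}-1}f_{j,s-H_{g-1},s-H_{g-1}}\big)}{\prod_{j=1}^{i_1}f_{j,s,s}}\qquad(1\le k\le s-1),$$ $$\tilde\varphi_{s,0}=\sum_{q=1}^{\infty}\sum_{\ell=1}^{s}\sum_{r=0}^{s-\ell}\ \sum_{\substack{h_1+\dots+h_r=s-\ell\\h_\nu\ge1}}\ \sum_{q+1\le i_r<\dots<i_1<\infty}\ f_{i_1,s,s-H_1}\frac{\prod_{g=2}^{r+1}\big(f_{i_g,s-H_{g-1},s-H_g}\prod_{j=i_g+1}^{i_{g-1}-1}f_{j,s-H_{g-1},s-H_{g-1}}\big)}{\prod_{j=1}^{i_1}f_{j,s,s}},$$ with the same conventions for $i_{r+1}$ and $H_{r+1}$ as before. Let $s^*=\min\{s,m\}$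 and $C=\Lambda\sigma/m$, let $\lambda_{1,s},\dots,\lambda_{s^*,s}$ be the negated complex roots of $$P_s(x)=\frac{s^*!}{\sigma^{s^*}}\sum_{\ell=0}^{s^*}\frac{\binom s\ell}{\binom{s^*}\ell}C^\ell\binom m\ell\binom{x\sigma+T_0-\ell}{s^*-\ell},$$ and let $\mu_{1,s},\dots,\mu_{s,s}$ be those of $$Q_s(x)=\frac1{\sigma^s}\sum_{\ell=0}^{s}\binom s\ell C^\ell\binom m\ell\,\ell!\,(x\sigma+T_0)^{s-\ell},$$ in both cases counted with multiplicity. **Theorem.** For every tenable affine large-index urn, in both models, and every integer $s\ge1$: 1. For all $n\ge 0$, $$\mathbb E[\tilde W_n^s]=\sum_{k=0}^{s}\varphi_{n,s,k}W_0^k .$$ 2. The infinite sums that define $\tilde\varphi_{s,k}$, $0\le k\le s-1$, converge (the inner sums over the times $i_g$, and for $k=0$ also the outer sum over $q$), and $\tilde\varphi_{s,k}=\lim_{n\to\infty}\varphi_{n,s,k}/\varphi_{n,s,s}$ for $0\le k\le s$. 3. The limit $E_s=\lim_{n\to\infty}\mathbb E\big[(\tilde W_n/n^{\Lambda})^s\big]$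 exists and $$E_s=\begin{cases}\displaystyle\prod_{\ell=1}^{s^*}\frac{\Gamma\big(\frac{T_0+1-\ell}{\sigma}\big)}{\Gamma(\lambda_{\ell,s})}\ \sum_{k=0}^{s}\tilde\varphi_{s,k}W_0^k,&\text{model }\mathcal M,\\[2ex]\displaystyle\frac{\Gamma\big(\frac{T_0}{\sigma}\big)^s}{\prod_{\ell=1}^{s}\Gamma(\mu_{\ell,s})}\ \sum_{k=0}^{s}\tilde\varphi_{s,k}W_0^k,&\text{model }\mathcal R.\end{cases}$$ -/

import Mathlib

open Finset Filter Topology MeasureTheory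

/-- The two sampling schemes: `M` draws the sample without replacement, `R` draws it
with replacement. -/
inductive SamplingModel where
  | M
  | R

/-- The probability that a sample of `m` balls from an urn with `w` white and `b` black balls
has exactly `k` white balls: hypergeometric for model `M`, binomial for model `R`. -/
noncomputable def drawProb (model : SamplingModel) (m w b k : ℕ) : ℝ :=
  match model with
  | .M => ((w.choose k : ℝ) * (b.choose (m - k) : ℝ)) / ((w + b).choose m : ℝ)
  | .R => (m.choose k : ℝ) * ((w : ℝ) ^ k * (b : ℝ) ^ (m - k)) / ((w : ℝ) + (b : ℝ)) ^ m

/-- A balanced two-colour urn scheme with sample size `m`. If the sample has `k` white and `m - k`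
black balls, then `a (m - k)` white and `b (m - k)` black balls are added (removed, if negative);
only `a 0, …, a m` and `b 0, …, b m` matter. -/
structure UrnScheme where
  m : ℕ
  σ : ℕ
  a : ℕ → ℤ
  b : ℕ → ℤ
  W₀ : ℕ
  B₀ : ℕ
  one_le_m : 1 ≤ m
  one_le_σ : 1 ≤ σ
  balanced : ∀ k ≤ m, a k + b k = (σ : ℤ)
  m_le_total : m ≤ W₀ + B₀

namespace UrnScheme

/-- The total number `T_n = T_0 + σ n` of balls after `n` draws. -/
def T (U : UrnScheme) (n : ℕ) : ℕ := U.W₀ + U.B₀ + U.σ * n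

/-- The urn is affine: the conditional mean of the number of white balls after the draw number
`n + 1`, given the content `(w, v)` of the urn after `n` draws, is an affine function of `w`,
with coefficients that depend on `n` only. -/
def IsAffine (U : UrnScheme) (model : SamplingModel) : Prop :=
  ∃ α β : ℕ → ℝ, ∀ n w v : ℕ, w + v = U.T n →
    ∑ k ∈ range (U.m + 1), drawProb model U.m w v k * ((w : ℝ) + (U.a (U.m - k) : ℝ))
      = α n * (w : ℝ) + β n

theorem hyp_sum (m w v : ℕ) : ∑ k ∈ range (m+1), (w.choose k) * (v.choose (m-k)) = (w+v).choose m := by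
  rw [Nat.add_choose_eq, Finset.Nat.sum_antidiagonal_eq_sum_range_succ_mk]

theorem hyp_mean (m w v : ℕ) : (w+v) * ∑ k ∈ range (m+1), (w.choose k) * (v.choose (m-k)) * k = m * w * (w+v).choose m := by
  rcases m with _ | m
  · simp
  rcases w with _ | w
  · simp [Finset.sum_range_succ']
  rw [Finset.sum_range_succ']
  have : ∀ k ∈ range (m+1), (w+1).choose (k+1) * v.choose (m+1-(k+1)) * (k+1) = (w+1) * (w.choose k * v.choose (m-k)) := by
    intro k _
    have h := Nat.add_one_mul_choose_eq w k
    rw [Nat.add_sub_add_right]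
    linear_combination v.choose (m-k) * (-h)
  rw [Finset.sum_congr rfl this, ← Finset.mul_sum, hyp_sum]
  have h := Nat.add_one_mul_choose_eq (w+v) m
  rw [show w + 1 + v = w+v+1 by ring]
  simp only [mul_zero, add_zero]
  linear_combination (w+1) * h

theorem bin_sum (m : ℕ) (x y : ℝ) : ∑ k ∈ range (m+1), (m.choose k : ℝ) * (x^k * y^(m-k)) = (x+y)^m := by
  rw [add_pow]; exact Finset.sum_congr rfl fun k _ => by ring

theorem bin_mean (m : ℕ) (x y : ℝ) : (x+y) * ∑ k ∈ range (m+1), (m.choose k : ℝ) * (x^k * y^(m-k)) * k = m * x * (x+y)^m := by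
  rcases m with _ | m
  · simp
  rw [Finset.sum_range_succ']
  have : ∀ k ∈ range (m+1), ((m+1).choose (k+1) : ℝ) * (x^(k+1) * y^(m+1-(k+1))) * ((k+1 : ℕ) : ℝ) = (m+1) * x * ((m.choose k : ℝ) * (x^k*y^(m-k))) := by
    intro k _
    have h : ((m:ℝ)+1) * (m.choose k) = ((m+1).choose (k+1)) * (k+1) := by exact_mod_cast Nat.add_one_mul_choose_eq m k
    rw [Nat.add_sub_add_right]; push_cast
    linear_combination x^(k+1) * y^(m-k) * (-h)
  rw [Finset.sum_congr rfl this, ← Finset.mul_sum, bin_sum]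
  push_cast; simp; ring

theorem bin_inj (m N : ℕ) (hm : 1 ≤ m) (hN : m ≤ N) (c : ℕ → ℝ)
   (h : ∀ w v : ℕ, w + v = N → ∑ k ∈ range (m+1), (m.choose k : ℝ) * ((w:ℝ)^k * (v:ℝ)^(m-k)) * c k = 0) :
   ∀ k ≤ m, c k = 0 := by
  have hN0 : (N:ℝ) ≠ 0 := by
    have : N ≠ 0 := by omega
    exact_mod_cast this
  have hcm : c m = 0 := by
    have h1 := h N 0 (by simp)
    rw [Finset.sum_range_succ, Finset.sum_eq_zero] at h1
    · simpa [hN0] using h1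
    · intro k hk; rw [mem_range] at hk
      simp [Nat.sub_ne_zero_of_lt hk]
  have key : (∑ k ∈ range m, Polynomial.C ((m.choose k : ℝ) * c k) * Polynomial.X ^ k : Polynomial ℝ) = 0 := by
    apply Polynomial.eq_zero_of_degree_lt_of_eval_index_eq_zero (s := range m) (v := fun w : ℕ => (w:ℝ) / ((N:ℝ) - w))
    · intro x hx y hy hxy
      simp only [coe_range, Set.mem_Iio] at hx hy
      have hx' : (x:ℝ) < N := by exact_mod_cast hx.trans_le hN
      have hy' : (y:ℝ) < N := by exact_mod_cast hy.trans_le hN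
      have h1 : (N:ℝ) - x ≠ 0 := by linarith
      have h2 : (N:ℝ) - y ≠ 0 := by linarith
      simp only at hxy
      rw [div_eq_div_iff h1 h2] at hxy
      have : (N:ℝ) * (x - y) = 0 := by linear_combination hxy
      have := (mul_eq_zero.mp this).resolve_left hN0
      exact_mod_cast sub_eq_zero.mp this
    · rw [card_range]
      refine (Polynomial.degree_sum_le _ _).trans_lt ?_
      rw [Finset.sup_lt_iff (by exact WithBot.bot_lt_coe m)]
      intro k hk
      exact (Polynomial.degree_C_mul_X_pow_le _ _).trans_lt (by exact_mod_cast mem_range.mp hk)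
    · intro w hw
      rw [mem_range] at hw
      have hwN : w < N := hw.trans_le hN
      have h1 := h w (N - w) (by omega)
      rw [Nat.cast_sub hwN.le, Finset.sum_range_succ, hcm, mul_zero, add_zero] at h1
      have hx' : (w:ℝ) < N := by exact_mod_cast hwN
      have h2 : (N:ℝ) - w ≠ 0 := by linarith
      rw [Polynomial.eval_finsetSum]
      refine (mul_eq_zero.mp ?_).resolve_left (pow_ne_zero m h2)
      rw [Finset.mul_sum, ← h1]
      refine Finset.sum_congr rfl fun k hk => ?_
      have hk' := (mem_range.mp hk).le
      simp only [Polynomial.eval_mul, Polynomial.eval_C, Polynomial.eval_pow, Polynomial.eval_X, div_pow]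
      obtain ⟨d, rfl⟩ := Nat.exists_eq_add_of_le hk'
      rw [Nat.add_sub_cancel_left, pow_add]
      field_simp
  intro k hk
  rcases hk.eq_or_lt with rfl | hk
  · exact hcm
  have := congrArg (fun p => Polynomial.coeff p k) key
  simp only [Polynomial.finsetSum_coeff, Polynomial.coeff_C_mul, Polynomial.coeff_X_pow, Polynomial.coeff_zero, mul_ite, mul_one, mul_zero, Finset.sum_ite_eq, mem_range, hk, if_true, mul_eq_zero] at this
  exact this.resolve_left (by exact_mod_cast (Nat.choose_pos hk.le).ne')

theorem hyp_inj (m N : ℕ) (hN : m ≤ N) (c : ℕ → ℝ)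
   (h : ∀ w v : ℕ, w + v = N → ∑ k ∈ range (m+1), (w.choose k : ℝ) * (v.choose (m-k) : ℝ) * c k = 0) :
   ∀ k ≤ m, c k = 0 := by
  intro k
  induction k using Nat.strong_induction_on with
  | _ k ih =>
    intro hk
    have h1 := h k (N-k) (by omega)
    rw [Finset.sum_eq_single k] at h1
    · rcases mul_eq_zero.mp h1 with h1 | h1
      · have : 0 < (N-k).choose (m-k) := Nat.choose_pos (by omega)
        simp at h1; omega
      · exact h1
    · intro j hj hjk
      rcases lt_or_gt_of_ne hjk with hj' | hj'
      · rw [ih j hj' (by omega), mul_zero]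
      · rw [Nat.choose_eq_zero_of_lt hj']; simp
    · intro h; exact absurd (mem_range.mpr (by omega)) h

theorem drawProb_sum (model : SamplingModel) (m w v : ℕ) (hm : 1 ≤ m) (h : m ≤ w + v) :
    ∑ k ∈ range (m + 1), drawProb model m w v k = 1 := by
  cases model with
  | M =>
    have h0 : ((w+v).choose m : ℝ) ≠ 0 := by exact_mod_cast (Nat.choose_pos h).ne'
    simp only [drawProb]
    rw [← Finset.sum_div, div_eq_one_iff_eq h0]
    exact_mod_cast hyp_sum m w v
  | R =>
    have h0 : ((w:ℝ)+v) ≠ 0 := by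
      have : w + v ≠ 0 := by omega
      exact_mod_cast this
    simp only [drawProb]
    rw [← Finset.sum_div, div_eq_one_iff_eq (pow_ne_zero _ h0)]
    exact bin_sum m w v

theorem drawProb_mean (model : SamplingModel) (m w v : ℕ) (hm : 1 ≤ m) (h : m ≤ w + v) :
    ∑ k ∈ range (m + 1), drawProb model m w v k * k = m * w / ((w:ℝ) + v) := by
  have hN : ((w:ℝ)+v) ≠ 0 := by
    have : w + v ≠ 0 := by omega
    exact_mod_cast this
  cases model with
  | M =>
    have h0 : ((w+v).choose m : ℝ) ≠ 0 := by exact_mod_cast (Nat.choose_pos h).ne'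
    have h1 : ((w:ℝ)+v) * ∑ k ∈ range (m+1), ((w.choose k : ℝ) * (v.choose (m-k))) * k = m * w * (w+v).choose m := by
      exact_mod_cast hyp_mean m w v
    simp only [drawProb, div_mul_eq_mul_div]
    rw [← Finset.sum_div, div_eq_div_iff h0 hN, ← h1]; ring
  | R =>
    have h1 := bin_mean m (w:ℝ) v
    simp only [drawProb, div_mul_eq_mul_div]
    rw [← Finset.sum_div, div_eq_div_iff (pow_ne_zero _ hN) hN, ← h1]; ring

theorem drawProb_inj (model : SamplingModel) (m N : ℕ) (hm : 1 ≤ m) (hN : m ≤ N) (c : ℕ → ℝ)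
    (h : ∀ w v : ℕ, w + v = N → ∑ k ∈ range (m+1), drawProb model m w v k * c k = 0) :
    ∀ k ≤ m, c k = 0 := by
  cases model with
  | M =>
    refine hyp_inj m N hN c fun w v hwv => ?_
    have h1 := h w v hwv
    have h0 : ((w+v).choose m : ℝ) ≠ 0 := by exact_mod_cast (Nat.choose_pos (hwv ▸ hN)).ne'
    simp only [drawProb, div_mul_eq_mul_div] at h1
    rw [← Finset.sum_div, div_eq_zero_iff] at h1
    exact h1.resolve_right h0
  | R =>
    refine bin_inj m N hm hN c fun w v hwv => ?_
    have h1 := h w v hwv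
    have h0 : ((w:ℝ)+v) ≠ 0 := by
      have : w + v ≠ 0 := by omega
      exact_mod_cast this
    simp only [drawProb, div_mul_eq_mul_div] at h1
    rw [← Finset.sum_div, div_eq_zero_iff] at h1
    exact h1.resolve_right (pow_ne_zero _ h0)

/-- An urn is affine if and only if `a_k = (m - k) (a_{m-1} - a_m) + a_m` for `0 ≤ k ≤ m`. -/
theorem isAffine_iff (U : UrnScheme) (model : SamplingModel) :
    U.IsAffine model ↔ ∀ k ≤ U.m,
      U.a k = ((U.m : ℤ) - k) * (U.a (U.m - 1) - U.a U.m) + U.a U.m := by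
  have hm := U.one_le_m
  constructor
  · rintro ⟨α, β, h⟩
    have hT : U.T 0 = U.W₀ + U.B₀ := by simp [UrnScheme.T]
    have hN : U.m ≤ U.T 0 := hT ▸ U.m_le_total
    have hm0 : (U.m : ℝ) ≠ 0 := by exact_mod_cast (by omega : U.m ≠ 0)
    have hT0 : (U.T 0 : ℝ) ≠ 0 := by exact_mod_cast (by omega : U.T 0 ≠ 0)
    obtain ⟨D, hD⟩ : ∃ D : ℝ, D = (α 0 - 1) * U.T 0 / U.m := ⟨_, rfl⟩
    have key := drawProb_inj model U.m (U.T 0) hm hN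
      (fun k => (U.a (U.m - k) : ℝ) - (D * k + β 0)) (by
        intro w v hwv
        have h1 := h 0 w v hwv
        have hs := drawProb_sum model U.m w v hm (hwv ▸ hN)
        have hme := drawProb_mean model U.m w v hm (hwv ▸ hN)
        have hwv' : (w:ℝ) + v = U.T 0 := by exact_mod_cast hwv
        have : ∀ k ∈ range (U.m+1), drawProb model U.m w v k * ((U.a (U.m - k) : ℝ) - (D * k + β 0))
          = drawProb model U.m w v k * ((w : ℝ) + (U.a (U.m - k) : ℝ)) - D * (drawProb model U.m w v k * k) - (β 0 + w) * drawProb model U.m w v k := by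
            intro k _; ring
        rw [Finset.sum_congr rfl this, Finset.sum_sub_distrib, Finset.sum_sub_distrib, ← Finset.mul_sum, ← Finset.mul_sum, h1, hs, hme, hwv', hD]
        field_simp
        ring)
    have e0 := key 0 (by omega)
    have e1 := key 1 hm
    intro k hk
    have ek := key (U.m - k) (by omega)
    simp only [Nat.sub_sub_self hk, Nat.cast_sub hk] at ek
    simp only [Nat.sub_zero, Nat.cast_zero, Nat.cast_one] at e0 e1
    have : (U.a k : ℝ) = ((U.m : ℝ) - k) * (U.a (U.m - 1) - U.a U.m) + U.a U.m := by
      linear_combination ek - e0 + ((U.m:ℝ) - k) * (e0 - e1)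
    exact_mod_cast this
  · intro h
    refine ⟨fun n => 1 + U.m * ((U.a (U.m - 1) : ℝ) - U.a U.m) / U.T n, fun _ => U.a U.m, ?_⟩
    intro n w v hwv
    have hN : U.m ≤ w + v := by
      rw [hwv, UrnScheme.T]; exact U.m_le_total.trans (Nat.le_add_right _ _)
    have hs := drawProb_sum model U.m w v hm hN
    have hme := drawProb_mean model U.m w v hm hN
    have hwv' : (w:ℝ) + v = U.T n := by exact_mod_cast hwv
    have : ∀ k ∈ range (U.m+1), drawProb model U.m w v k * ((w : ℝ) + (U.a (U.m - k) : ℝ))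
      = ((U.a (U.m - 1) : ℝ) - U.a U.m) * (drawProb model U.m w v k * k) + (w + U.a U.m) * drawProb model U.m w v k := by
        intro k hk
        have hk' : k ≤ U.m := by have := mem_range.mp hk; omega
        have h1 := h (U.m - k) (Nat.sub_le _ _)
        rw [Nat.cast_sub hk'] at h1
        have h2 : (U.a (U.m - k) : ℝ) = ((U.m : ℝ) - ((U.m:ℝ) - k)) * (U.a (U.m - 1) - U.a U.m) + U.a U.m := by exact_mod_cast h1
        rw [h2]; ring
    rw [Finset.sum_congr rfl this, Finset.sum_add_distrib, ← Finset.mul_sum, ← Finset.mul_sum, hs, hme, hwv']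
    ring


/-- The urn index `Λ = (m / σ) (a_{m-1} - a_m)`. -/
noncomputable def Λ (U : UrnScheme) : ℝ :=
  (U.m : ℝ) / (U.σ : ℝ) * ((U.a (U.m - 1) : ℝ) - (U.a U.m : ℝ))

/-- Large-index urns. -/
def IsLargeIndex (U : UrnScheme) : Prop :=
  U.a U.m ≠ 0 ∧ 1 / 2 < U.Λ ∧ U.Λ < 1

/-- The sigma-algebra generated by the first `n` draws; `X j` is the number of white balls in
the sample number `j + 1`. -/
abbrev drawsSigma {Ω : Type*} (X : ℕ → Ω → ℕ) (n : ℕ) : MeasurableSpace Ω :=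
  ⨆ j : Fin n, MeasurableSpace.comap (X j) ⊤

/-- `(W n, B n)` are the numbers of white and black balls after `n` draws from the urn `U`,
where `X n` is the number of white balls in the sample number `n + 1`. Tenability is expressed by
the fact that the numbers of balls are natural numbers for ever. -/
structure IsEvolution (U : UrnScheme) (model : SamplingModel) {Ω : Type*} [MeasurableSpace Ω]
    (μ : Measure Ω) (X W B : ℕ → Ω → ℕ) : Prop where
  measurable_draw : ∀ n, Measurable (X n)
  draw_le : ∀ n ω, X n ω ≤ U.m
  white_zero : ∀ ω, W 0 ω = U.W₀
  black_zero : ∀ ω, B 0 ω = U.B₀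
  white_succ : ∀ n ω, (W (n + 1) ω : ℤ) = (W n ω : ℤ) + U.a (U.m - X n ω)
  black_succ : ∀ n ω, (B (n + 1) ω : ℤ) = (B n ω : ℤ) + U.b (U.m - X n ω)
  condProb_draw : ∀ n, ∀ k ≤ U.m,
    μ[(X n ⁻¹' {k}).indicator (fun _ => (1 : ℝ)) | drawsSigma X n]
      =ᵐ[μ] fun ω => drawProb model U.m (W n ω) (B n ω) k

/-- The shifted variable `W̃_n = W_n - n a_m / (1 - Λ)`. -/
noncomputable def shifted (U : UrnScheme) {Ω : Type*} (W : ℕ → Ω → ℕ) (n : ℕ) (ω : Ω) : ℝ :=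
  (W n ω : ℝ) - (n : ℝ) * (U.a U.m : ℝ) / (1 - U.Λ)

/-- The coefficient `p_{n;(i,l)}` (for `n ≥ 1`) of `w ^ l` in the `i`-th moment of the number of
white balls in the sample number `n`, drawn from an urn with `w` white balls and `T_{n-1}` balls
in total. -/
noncomputable def sampleCoeff (U : UrnScheme) (model : SamplingModel) (n i l : ℕ) : ℝ :=
  match model with
  | .M => ∑ h ∈ Icc l (min i U.m), (-1 : ℝ) ^ (h - l) *
      ((Nat.stirlingFirst h l : ℝ) * (Nat.stirlingSecond i h : ℝ) * (U.m.choose h : ℝ)) /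
        ((U.T (n - 1)).choose h : ℝ)
  | .R => (Nat.stirlingSecond i l : ℝ) * (U.m.descFactorial l : ℝ) / (U.T (n - 1) : ℝ) ^ l

/-- The coefficients `f_{n,s,r}` for `n ≥ 1` and `0 ≤ r ≤ s`, with the convention
`f_{0,s,r} = 1`. -/
noncomputable def f (U : UrnScheme) (model : SamplingModel) (n s r : ℕ) : ℝ :=
  if n = 0 then 1 else
  ∑ j ∈ Icc (s - r) s, (s.choose j : ℝ) * U.Λ ^ j *
    ∑ l ∈ Icc (j - (s - r)) j, (l.choose (j - (s - r)) : ℝ) *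
      ((U.a U.m : ℝ) * ((n : ℝ) - 1) / (1 - U.Λ)) ^ (l - (j - (s - r))) *
      ∑ i ∈ Icc l j, (j.choose i : ℝ) *
        ((U.σ : ℝ) ^ i * (U.a U.m : ℝ) ^ (j - i) / ((U.m : ℝ) ^ i * (U.Λ - 1) ^ (j - i))) *
        U.sampleCoeff model n i l

/-- The jump heights: all `(h_1, …, h_r)` with `h_ν ≥ 1` and sum `d`. -/
def jumpHeights (r d : ℕ) : Finset (Fin r → ℕ) :=
  {h ∈ Fintype.piFinset (fun _ : Fin r => Icc 1 d) | ∑ ν, h ν = d}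

open Classical in
/-- The jump times `n ≥ i_1 > … > i_r ≥ q + 1`. -/
noncomputable def jumpTimes (n r q : ℕ) : Finset (Fin r → ℕ) :=
  {i ∈ Fintype.piFinset (fun _ : Fin r => Icc (q + 1) n) | StrictAnti i}

/-- The jump times `∞ > i_1 > … > i_r ≥ q + 1`. -/
def unboundedJumpTimes (r q : ℕ) : Set (Fin r → ℕ) :=
  {i | StrictAnti i ∧ ∀ g, q + 1 ≤ i g}

/-- The times `i_0 = top`, `i_1, …, i_r` and `i_{r+1} = q`. -/
def jumpTime {r : ℕ} (top q : ℕ) (i : Fin r → ℕ) (g : ℕ) : ℕ :=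
  if g = 0 then top else if hg : g - 1 < r then i ⟨g - 1, hg⟩ else q

/-- The partial sums `H_g = h_1 + … + h_g` for `0 ≤ g ≤ r`, and `H_{r+1} = s`. -/
def height {r : ℕ} (s : ℕ) (h : Fin r → ℕ) (g : ℕ) : ℕ :=
  if g ≤ r then ∑ ν : Fin r, (if (ν : ℕ) < g then h ν else 0) else s

/-- The factor `f_{i_g, s-H_{g-1}, s-H_g} ∏_{j = i_g + 1}^{i_{g-1} - 1} f_{j, s-H_{g-1}, s-H_{g-1}}`
of the weight of a path. -/
noncomputable def pathFactor (U : UrnScheme) (model : SamplingModel) {r : ℕ} (s top q : ℕ)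
    (h i : Fin r → ℕ) (g : ℕ) : ℝ :=
  U.f model (jumpTime top q i g) (s - height s h (g - 1)) (s - height s h g) *
    ∏ j ∈ Icc (jumpTime top q i g + 1) (jumpTime top q i (g - 1) - 1),
      U.f model j (s - height s h (g - 1)) (s - height s h (g - 1))

/-- The weight `∏_{g=1}^{r+1}` of these factors, with `i_0 = n + 1` and `i_{r+1} = q`. For `q = 0`
this is the weight of a path from `(n, s)` to `(0, s - H_r)` (the factor `f_{i_{r+1}, ⬝, ⬝}` being
`1` by convention); for `q ≥ 1` that of a path from `(n, s)` to the sink `(q - 1, 0)` whose last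
step is a jump to level `0`. -/
noncomputable def pathWeight (U : UrnScheme) (model : SamplingModel) {r : ℕ} (n s q : ℕ)
    (h i : Fin r → ℕ) : ℝ :=
  ∏ g ∈ Icc 1 (r + 1), U.pathFactor model s (n + 1) q h i g

/-- The weight of a path after division by `∏_{j=1}^n f_{j,s,s}`; it does not depend on `n`. -/
noncomputable def limitWeight (U : UrnScheme) (model : SamplingModel) {r : ℕ} (s q : ℕ)
    (h i : Fin r → ℕ) : ℝ :=
  U.f model (jumpTime 0 q i 1) s (s - height s h 1) *
    (∏ g ∈ Icc 2 (r + 1), U.pathFactor model s 0 q h i g) /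
    ∏ j ∈ Icc 1 (jumpTime 0 q i 1), U.f model j s s

/-- The coefficients `φ_{n,s,k}`, for `s ≥ 1` and `0 ≤ k ≤ s`. -/
noncomputable def phi (U : UrnScheme) (model : SamplingModel) (n s k : ℕ) : ℝ :=
  if k = s then ∏ j ∈ Icc 1 n, U.f model j s s
  else if k = 0 then
    ∑ q ∈ Icc 1 n, ∑ l ∈ Icc 1 s, ∑ r ∈ Icc 0 (s - l), ∑ h ∈ jumpHeights r (s - l),
      ∑ i ∈ jumpTimes n r q, U.pathWeight model n s q h i
  else
    ∑ r ∈ Icc 1 (s - k), ∑ h ∈ jumpHeights r (s - k),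
      ∑ i ∈ jumpTimes n r 0, U.pathWeight model n s 0 h i

/-- The term with index `q ≥ 1` of the infinite sum `φ̃_{s,0}`. -/
noncomputable def constTerm (U : UrnScheme) (model : SamplingModel) (s q : ℕ) : ℝ :=
  ∑ l ∈ Icc 1 s, ∑ r ∈ Icc 0 (s - l), ∑ h ∈ jumpHeights r (s - l),
    ∑' i : unboundedJumpTimes r q, U.limitWeight model s q h i.1

/-- The nested infinite sums `φ̃_{s,k}`, for `s ≥ 1` and `0 ≤ k ≤ s`. -/
noncomputable def phiTilde (U : UrnScheme) (model : SamplingModel) (s k : ℕ) : ℝ :=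
  if k = s then 1
  else if k = 0 then ∑' q : ℕ, U.constTerm model s (q + 1)
  else
    ∑ r ∈ Icc 1 (s - k), ∑ h ∈ jumpHeights r (s - k),
      ∑' i : unboundedJumpTimes r 0, U.limitWeight model s 0 h i.1

/-- The binomial coefficient polynomial `binom(x σ + T_0 - l, d)` in the variable `x`. -/
noncomputable def binomPoly (U : UrnScheme) (l d : ℕ) : Polynomial ℂ :=
  Polynomial.C (1 / (d.factorial : ℂ)) * (descPochhammer ℂ d).comp
    (Polynomial.C (U.σ : ℂ) * Polynomial.X + Polynomial.C ((U.T 0 : ℂ) - (l : ℂ)))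

/-- The constant `C = Λ σ / m`. -/
noncomputable def jumpConst (U : UrnScheme) : ℝ := U.Λ * (U.σ : ℝ) / (U.m : ℝ)

/-- The monic polynomial `P_s` of degree `s* = min s m`. -/
noncomputable def polyP (U : UrnScheme) (s : ℕ) : Polynomial ℂ :=
  Polynomial.C (((min s U.m).factorial : ℂ) / (U.σ : ℂ) ^ (min s U.m)) *
    ∑ l ∈ range (min s U.m + 1),
      Polynomial.C ((s.choose l : ℂ) / ((min s U.m).choose l : ℂ) *
        (U.jumpConst : ℂ) ^ l * (U.m.choose l : ℂ)) * U.binomPoly l (min s U.m - l)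

/-- The monic polynomial `Q_s` of degree `s`. -/
noncomputable def polyQ (U : UrnScheme) (s : ℕ) : Polynomial ℂ :=
  Polynomial.C (1 / (U.σ : ℂ) ^ s) *
    ∑ l ∈ range (s + 1),
      Polynomial.C ((s.choose l : ℂ) * (U.jumpConst : ℂ) ^ l * (U.m.choose l : ℂ) *
        (l.factorial : ℂ)) *
        (Polynomial.C (U.σ : ℂ) * Polynomial.X + Polynomial.C (U.T 0 : ℂ)) ^ (s - l)

/-- The Gamma prefactor: `∏_{l=1}^{s*} Γ((T_0 + 1 - l) / σ) / Γ(λ_{l,s})` for model `M` and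
`Γ(T_0 / σ) ^ s / ∏_{l=1}^{s} Γ(μ_{l,s})` for model `R`, where the `λ_{l,s}` and the `μ_{l,s}` are
the negated complex roots, with multiplicity, of `P_s` and of `Q_s`. -/
noncomputable def gammaFactor (U : UrnScheme) (model : SamplingModel) (s : ℕ) : ℂ :=
  match model with
  | .M => (∏ l ∈ Icc 1 (min s U.m),
        Complex.Gamma (((U.T 0 : ℂ) + 1 - (l : ℂ)) / (U.σ : ℂ))) /
      ((U.polyP s).roots.map (fun z => Complex.Gamma (-z))).prod
  | .R => Complex.Gamma ((U.T 0 : ℂ) / (U.σ : ℂ)) ^ s /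
      ((U.polyQ s).roots.map (fun z => Complex.Gamma (-z))).prod

end UrnScheme

/-! For an affine urn the shifted variable after one more draw equals its old value `x` plus `Λ (σ k
/ m + a_m / (Λ - 1))`, where `k` is the number of white balls in the sample. The `i`-th moment of
`k` is a polynomial in the number of white balls, of degree at most `i`, with coefficients
`sampleCoeff`. Hence the conditional mean of the `s`-th power is `∑_{r ≤ s} f_{n+1,s,r} x^r`
(`sum_drawProb_mul_shifted_pow`), and the moments satisfy a triangular linear recursion
(`integral_shifted_succ_pow`).

Iterating the recursion gives a sum over paths that descend from level `s`. Let `D_{n,s}` be the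
product of the diagonal coefficients (`diagProd`). By telescoping, the weight of a path is `D_{n,s}`
times a product of jump weights `f_{i,s,r} D_{i-1,r} / D_{i,s}`, one for each jump
(`pathWeight_eq`). Splitting off the latest jump shows that `φ_{n,s,k} / D_{n,s}` obeys the
normalized recursion (`phi_div_succ`), which proves the moment formula. Level `0` carries weight `1`
at all times, so the paths that end there are sorted by the time `q` of their last jump.

Two asymptotic facts yield the limits. First, `f_{n+1,s,s}` is a rational function of `n` equal to
`1 + sΛ/n + o(1/n)`; its numerator is `P_s` or `Q_s`, and Euler's limit formula for the Gamma
function gives `D_{n,s} ~ γ n^{sΛ}` with a nonzero constant `γ` (`tendsto_prod_div_cpow`). Second,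
every jump weight is summable over time (`summable_jumpWeight`). A jump by at least two levels has
weight `O(n^{-2Λ})`, and `2Λ > 1`. A jump by one level has weight `O(n^{-1-Λ})`, because the shift
makes the leading term of `f_{n,s,s-1}` cancel (`f_isBigO_inv`). The sums over paths are thus
dominated by products of convergent series, and dominated convergence identifies the limits of
`φ_{n,s,k} / φ_{n,s,s}`. -/

/-! ### Stirling numbers and the moments of a sample -/

theorem Nat.cast_descFactorial_succ_sub (w h : ℕ) :
    (w.descFactorial (h + 1) : ℝ) = ((w : ℝ) - h) * w.descFactorial h := by
  rw [Nat.descFactorial_succ]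
  rcases le_or_gt h w with hw | hw
  · rw [Nat.cast_mul, Nat.cast_sub hw]
  · rw [Nat.descFactorial_of_lt hw]; simp

theorem pow_eq_sum_stirlingSecond (k i : ℕ) :
    (k : ℝ) ^ i = ∑ h ∈ range (i + 1), (Nat.stirlingSecond i h : ℝ) * k.descFactorial h := by
  induction i with
  | zero => simp
  | succ i ih =>
    rw [sum_range_succ']
    simp only [Nat.stirlingSecond_succ_succ, Nat.stirlingSecond_succ_zero, Nat.cast_zero, zero_mul,
      add_zero, Nat.cast_add, Nat.cast_mul, add_mul, sum_add_distrib]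
    -- An index shift by one; both boundary terms vanish, at `0` by the factor `h` and at `i + 1` by
    -- the Stirling number.
    have h1 : ∑ h ∈ range (i + 1), ((h : ℝ) + 1) * Nat.stirlingSecond i (h + 1) *
        k.descFactorial (h + 1)
        = ∑ h ∈ range (i + 1), (h : ℝ) * (Nat.stirlingSecond i h * k.descFactorial h) := by
      have h2 := sum_range_succ' (fun h : ℕ => (h : ℝ) *
        (Nat.stirlingSecond i h * k.descFactorial h : ℝ)) (i + 1)
      rw [sum_range_succ, Nat.stirlingSecond_eq_zero_of_lt (Nat.lt_succ_self i)] at h2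
      simp only [Nat.cast_zero, zero_mul, mul_zero, add_zero] at h2
      rw [h2]
      exact sum_congr rfl fun h _ => by push_cast; ring
    rw [pow_succ, ih, sum_mul]
    push_cast
    simp only [add_mul] at h1
    rw [sum_add_distrib] at h1
    rw [h1, ← sum_add_distrib]
    refine sum_congr rfl fun h _ => ?_
    rw [Nat.cast_descFactorial_succ_sub]; ring

theorem descFactorial_eq_sum_stirlingFirst (w h : ℕ) :
    (w.descFactorial h : ℝ)
      = ∑ l ∈ range (h + 1), (-1 : ℝ) ^ (h - l) * Nat.stirlingFirst h l * (w : ℝ) ^ l := by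
  induction h with
  | zero => simp
  | succ h ih =>
    rw [Nat.cast_descFactorial_succ_sub, ih, sum_range_succ' _ (h + 1)]
    have h1 : ∑ l ∈ range (h + 1), (-1 : ℝ) ^ (h - l) * (h * Nat.stirlingFirst h (l + 1)) *
        (w : ℝ) ^ (l + 1)
        = - ∑ l ∈ range (h + 1), (h : ℝ) * ((-1 : ℝ) ^ (h - l) * Nat.stirlingFirst h l *
          (w : ℝ) ^ l) := by
      have h2 := sum_range_succ' (fun l : ℕ => (h : ℝ) *
        ((-1 : ℝ) ^ (h - l) * Nat.stirlingFirst h l * (w : ℝ) ^ l)) (h + 1)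
      rw [sum_range_succ, Nat.stirlingFirst_eq_zero_of_lt (Nat.lt_succ_self h)] at h2
      have h3 : (h : ℝ) * Nat.stirlingFirst h 0 = 0 := by
        cases h <;> simp
      have h4 : (h : ℝ) * ((-1 : ℝ) ^ (h - 0) * Nat.stirlingFirst h 0 * (w : ℝ) ^ 0) = 0 := by
        linear_combination (-1 : ℝ) ^ (h - 0) * (w : ℝ) ^ 0 * h3
      rw [h4] at h2
      simp only [Nat.cast_zero, zero_mul, mul_zero, add_zero] at h2
      rw [h2, ← sum_neg_distrib]
      refine sum_congr rfl fun l hl => ?_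
      rcases Nat.lt_or_ge l h with hl' | hl'
      · obtain ⟨d, rfl⟩ := Nat.exists_eq_add_of_lt hl'
        rw [show l + d + 1 - l = d + 1 by omega, show l + d + 1 - (l + 1) = d by omega]
        ring
      · rw [Nat.stirlingFirst_eq_zero_of_lt (by omega)]; simp
    have h5 : (-1 : ℝ) ^ (h + 1 - 0) * Nat.stirlingFirst (h + 1) 0 * (w : ℝ) ^ 0 = 0 := by simp
    rw [h5, add_zero]
    have h6 : ∀ l ∈ range (h + 1), (-1 : ℝ) ^ (h + 1 - (l + 1)) *
        (Nat.stirlingFirst (h + 1) (l + 1) : ℝ) * (w : ℝ) ^ (l + 1)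
        = (-1 : ℝ) ^ (h - l) * (h * Nat.stirlingFirst h (l + 1)) * (w : ℝ) ^ (l + 1)
          + w * ((-1 : ℝ) ^ (h - l) * Nat.stirlingFirst h l * (w : ℝ) ^ l) := by
      intro l _
      rw [Nat.stirlingFirst_succ_succ, Nat.add_sub_add_right]; push_cast; ring
    rw [sum_congr rfl h6, sum_add_distrib, h1, ← mul_sum, ← mul_sum]
    ring

theorem choose_mul_descFactorial {w k h : ℕ} (hk : h ≤ k) :
    w.choose k * k.descFactorial h = w.descFactorial h * (w - h).choose (k - h) := by
  rw [Nat.descFactorial_eq_factorial_mul_choose, Nat.descFactorial_eq_factorial_mul_choose]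
  have := Nat.choose_mul (n := w) hk
  linear_combination h.factorial * this

/-- The falling factorial is absorbed into the binomial coefficient of `w`; what remains is
Vandermonde's identity for `w - h` and `v`. For `w < h` both sides vanish. -/
theorem sum_choose_mul_choose_mul_descFactorial {m w v h : ℕ} (hm : h ≤ m) :
    ∑ k ∈ range (m + 1), w.choose k * v.choose (m - k) * k.descFactorial h
      = w.descFactorial h * (w + v - h).choose (m - h) := by
  rcases Nat.lt_or_ge w h with hw | hw
  · rw [Nat.descFactorial_of_lt hw, zero_mul]
    refine sum_eq_zero fun k _ => ?_
    rcases Nat.lt_or_ge k h with hk | hk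
    · rw [Nat.descFactorial_of_lt hk, mul_zero]
    · rw [Nat.choose_eq_zero_of_lt (by omega : w < k)]; simp
  · rw [show m + 1 = h + (m - h + 1) by omega, sum_range_add, sum_eq_zero, zero_add,
      show w + v - h = w - h + v by omega, ← UrnScheme.hyp_sum, mul_sum]
    · refine sum_congr rfl fun k _ => ?_
      have := choose_mul_descFactorial (w := w) (Nat.le_add_right h k)
      rw [Nat.add_sub_cancel_left] at this
      rw [show m - (h + k) = m - h - k by omega]
      linear_combination v.choose (m - h - k) * this
    · intro k hk
      rw [Nat.descFactorial_of_lt (mem_range.mp hk), mul_zero]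

/-- The same absorption, now into the binomial coefficient of `m`, leaves the binomial theorem with
exponent `m - h`. -/
theorem sum_choose_mul_pow_mul_descFactorial {m h : ℕ} (hm : h ≤ m) (x y : ℝ) :
    ∑ k ∈ range (m + 1), (m.choose k : ℝ) * (x ^ k * y ^ (m - k)) * k.descFactorial h
      = m.descFactorial h * x ^ h * (x + y) ^ (m - h) := by
  rw [show m + 1 = h + (m - h + 1) by omega, sum_range_add, sum_eq_zero, zero_add,
    ← UrnScheme.bin_sum, mul_sum]
  · refine sum_congr rfl fun k _ => ?_
    have h1 := choose_mul_descFactorial (w := m) (Nat.le_add_right h k)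
    rw [Nat.add_sub_cancel_left] at h1
    have h2 : (m.choose (h + k) : ℝ) * (h + k).descFactorial h
      = m.descFactorial h * (m - h).choose k := by exact_mod_cast h1
    rw [show m - (h + k) = m - h - k by omega, pow_add]
    linear_combination x ^ h * x ^ k * y ^ (m - h - k) * h2
  · intro k hk
    rw [Nat.descFactorial_of_lt (mem_range.mp hk)]; simp

/-- The factorial moments of the number of white balls in a sample. -/
theorem drawProb_factorialMoment (model : SamplingModel) {m w v : ℕ} (hm : 1 ≤ m)
    (hN : m ≤ w + v) (h : ℕ) :
    ∑ k ∈ range (m + 1), drawProb model m w v k * k.descFactorial h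
      = match model with
        | .M => (m.choose h : ℝ) * w.descFactorial h / ((w + v).choose h : ℝ)
        | .R => (m.descFactorial h : ℝ) * (w : ℝ) ^ h / ((w + v : ℕ) : ℝ) ^ h := by
  rcases Nat.lt_or_ge m h with hh | hh
  · rw [sum_eq_zero]
    · cases model <;> simp [Nat.choose_eq_zero_of_lt hh, Nat.descFactorial_of_lt hh]
    · intro k hk
      rw [Nat.descFactorial_of_lt (by have := mem_range.mp hk; omega)]; simp
  cases model with
  | M =>
    have h0 : ((w + v).choose m : ℝ) ≠ 0 := by exact_mod_cast (Nat.choose_pos hN).ne'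
    have h0' : ((w + v).choose h : ℝ) ≠ 0 := by
      exact_mod_cast (Nat.choose_pos (hh.trans hN)).ne'
    have h1 : ∑ k ∈ range (m + 1), (w.choose k : ℝ) * v.choose (m - k) * k.descFactorial h
      = w.descFactorial h * (w + v - h).choose (m - h) := by
        exact_mod_cast sum_choose_mul_choose_mul_descFactorial (w := w) (v := v) hh
    have h2 : ((w + v).choose m : ℝ) * m.choose h = (w + v).choose h * (w + v - h).choose (m - h) := by
      exact_mod_cast Nat.choose_mul hh
    simp only [drawProb, div_mul_eq_mul_div]
    rw [← Finset.sum_div, h1, div_eq_div_iff h0 h0']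
    linear_combination -(w.descFactorial h : ℝ) * h2
  | R =>
    have h0 : ((w : ℝ) + v) ≠ 0 := by
      have : w + v ≠ 0 := by omega
      exact_mod_cast this
    simp only [drawProb, div_mul_eq_mul_div]
    rw [← Finset.sum_div, sum_choose_mul_pow_mul_descFactorial hh, Nat.cast_add,
      div_eq_div_iff (pow_ne_zero _ h0) (pow_ne_zero _ h0), mul_assoc, ← pow_add,
      Nat.sub_add_cancel hh]

namespace UrnScheme

variable (U : UrnScheme) (model : SamplingModel)

theorem T_pos (n : ℕ) : 0 < U.T n := by
  have := U.one_le_m; have := U.m_le_total; unfold T; omega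

theorem m_le_T (n : ℕ) : U.m ≤ U.T n := by
  have := U.m_le_total; unfold T; omega

theorem sampleCoeff_eq_zero {n i l : ℕ} (h : i < l) : U.sampleCoeff model n i l = 0 := by
  cases model with
  | M =>
    simp only [sampleCoeff]
    rw [Icc_eq_empty (by rw [le_min_iff]; omega), sum_empty]
  | R => simp [sampleCoeff, Nat.stirlingSecond_eq_zero_of_lt h]

/-- The moments of the number of white balls in a sample. -/
theorem drawProb_moment {n w v : ℕ} (hT : w + v = U.T n) (i : ℕ) :
    ∑ k ∈ range (U.m + 1), drawProb model U.m w v k * (k : ℝ) ^ i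
      = ∑ l ∈ range (i + 1), U.sampleCoeff model (n + 1) i l * (w : ℝ) ^ l := by
  have h1 : ∀ k ∈ range (U.m + 1), drawProb model U.m w v k * (k : ℝ) ^ i
      = ∑ h ∈ range (i + 1), (Nat.stirlingSecond i h : ℝ) *
          (drawProb model U.m w v k * k.descFactorial h) := by
    intro k _
    rw [pow_eq_sum_stirlingSecond, mul_sum]
    exact sum_congr rfl fun h _ => by ring
  have hN : U.m ≤ w + v := hT ▸ U.m_le_T n
  rw [sum_congr rfl h1, sum_comm]
  simp only [← mul_sum, drawProb_factorialMoment model U.one_le_m hN]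
  cases model with
  | M =>
    simp only [sampleCoeff, Nat.add_sub_cancel, hT]
    simp only [descFactorial_eq_sum_stirlingFirst, mul_sum, sum_mul, sum_div]
    rw [sum_sigma', sum_sigma']
    -- A sample of `m` balls has no factorial moments of order above `m`; this accounts for the
    -- bound `min i m` in `sampleCoeff`.
    have h2 : ∀ h l : ℕ, (h ≤ i ∧ l ≤ h) → ¬ h ≤ U.m → (Nat.stirlingSecond i h : ℝ) *
      ((U.m.choose h : ℝ) * ((-1 : ℝ) ^ (h - l) * Nat.stirlingFirst h l * (w : ℝ) ^ l) / (U.T n).choose h) = 0 := by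
      intro h l _ hh
      rw [Nat.choose_eq_zero_of_lt (by omega : U.m < h)]; simp
    symm
    refine sum_bij_ne_zero (fun x _ _ => ⟨x.2, x.1⟩) ?_ ?_ ?_ ?_
    · rintro ⟨l, h⟩ hx _
      simp only [mem_sigma, mem_range, mem_Icc, le_min_iff] at hx ⊢
      omega
    · rintro ⟨l, h⟩ _ _ ⟨l', h'⟩ _ _ hh
      simp only [Sigma.mk.injEq, heq_eq_eq] at hh ⊢
      exact ⟨hh.2, hh.1⟩
    · rintro ⟨h, l⟩ hx hne
      simp only [mem_sigma, mem_range] at hx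
      have hh : h ≤ U.m := by
        by_contra hh
        exact hne (h2 h l (by omega) hh)
      refine ⟨⟨l, h⟩, ?_, ?_, rfl⟩
      · simp only [mem_sigma, mem_range, mem_Icc, le_min_iff]; omega
      · intro h0; apply hne; rw [← h0]; dsimp only; ring
    · rintro ⟨l, h⟩ _ _
      dsimp only; ring
  | R =>
    simp only [sampleCoeff, Nat.add_sub_cancel, hT]
    exact sum_congr rfl fun h _ => by ring

end UrnScheme

/-! ### The moment recursion -/

namespace UrnScheme

variable (U : UrnScheme) (model : SamplingModel)

/-- The coefficients `f` as sums over full ranges. -/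
theorem f_succ (n s r : ℕ) :
    U.f model (n + 1) s r = ∑ j ∈ Icc (s - r) s, (s.choose j : ℝ) * U.Λ ^ j *
      ∑ l ∈ range (j + 1), (l.choose (j - (s - r)) : ℝ) *
        ((U.a U.m : ℝ) * n / (1 - U.Λ)) ^ (l - (j - (s - r))) *
        ∑ i ∈ range (j + 1), (j.choose i : ℝ) *
          ((U.σ : ℝ) ^ i * (U.a U.m : ℝ) ^ (j - i) / ((U.m : ℝ) ^ i * (U.Λ - 1) ^ (j - i))) *
          U.sampleCoeff model (n + 1) i l := by
  rw [f, if_neg n.succ_ne_zero]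
  refine sum_congr rfl fun j _ => congrArg _ ?_
  have h1 : ((n + 1 : ℕ) : ℝ) - 1 = n := by push_cast; ring
  rw [h1]
  have h2 : Icc (j - (s - r)) j ⊆ range (j + 1) := fun l hl => by
    simp only [mem_Icc, mem_range] at hl ⊢; omega
  rw [← sum_subset h2]
  · refine sum_congr rfl fun l _ => congrArg _ ?_
    have h3 : Icc l j ⊆ range (j + 1) := fun l hl => by
      simp only [mem_Icc, mem_range] at hl ⊢; omega
    refine sum_subset h3 fun i hi hi' => ?_
    simp only [mem_Icc, mem_range] at hi hi'
    rw [U.sampleCoeff_eq_zero model (by omega), mul_zero]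
  · intro l hl hl'
    simp only [mem_Icc, mem_range] at hl hl'
    rw [Nat.choose_eq_zero_of_lt (by omega)]; simp

/-- The conditional mean of a power of the shifted variable after one more draw. -/
theorem sum_drawProb_mul_shifted_pow (hA : U.IsAffine model) (hΛ : U.Λ ≠ 1) {n w v : ℕ}
    (hT : w + v = U.T n) (s : ℕ) :
    ∑ k ∈ range (U.m + 1), drawProb model U.m w v k *
        ((w : ℝ) + (U.a (U.m - k) : ℝ) - ((n + 1 : ℕ) : ℝ) * U.a U.m / (1 - U.Λ)) ^ s
      = ∑ r ∈ range (s + 1), U.f model (n + 1) s r *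
        ((w : ℝ) - (n : ℝ) * U.a U.m / (1 - U.Λ)) ^ r := by
  have hΛ' : 1 - U.Λ ≠ 0 := sub_ne_zero.mpr hΛ.symm
  have hΛ'' : U.Λ - 1 ≠ 0 := sub_ne_zero.mpr hΛ
  have hm : (U.m : ℝ) ≠ 0 := by exact_mod_cast (by have := U.one_le_m; omega : U.m ≠ 0)
  have hσ : (U.σ : ℝ) ≠ 0 := by exact_mod_cast (by have := U.one_le_σ; omega : U.σ ≠ 0)
  obtain ⟨A, hAd⟩ : ∃ A : ℝ, A = U.a U.m := ⟨_, rfl⟩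
  obtain ⟨x, hx⟩ : ∃ x : ℝ, x = (w : ℝ) - (n : ℝ) * A / (1 - U.Λ) := ⟨_, rfl⟩
  obtain ⟨c, hc⟩ : ∃ c : ℝ, c = A * n / (1 - U.Λ) := ⟨_, rfl⟩
  have hw : (w : ℝ) = x + c := by rw [hx, hc]; ring
  -- By affinity `a_{m-k} = k (a_{m-1} - a_m) + a_m` with `a_{m-1} - a_m = Λσ/m`, and `a_m -
  -- a_m/(1-Λ) = Λ a_m/(Λ-1)`.
  have hstep : ∀ k ∈ range (U.m + 1), (w : ℝ) + (U.a (U.m - k) : ℝ) -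
      ((n + 1 : ℕ) : ℝ) * A / (1 - U.Λ)
      = U.Λ * (U.σ / U.m * k + A / (U.Λ - 1)) + x := by
    intro k hk
    have hk' : k ≤ U.m := by have := mem_range.mp hk; omega
    have h1 := (isAffine_iff U model).mp hA (U.m - k) (Nat.sub_le _ _)
    rw [Nat.cast_sub hk'] at h1
    have h2 : (U.a (U.m - k) : ℝ) = ((U.m : ℝ) - ((U.m : ℝ) - k)) *
      (U.a (U.m - 1) - U.a U.m) + U.a U.m := by exact_mod_cast h1
    have h3 : U.Λ * (U.σ / U.m) = U.a (U.m - 1) - U.a U.m := by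
      rw [Λ]; field_simp
    rw [h2, hx, ← hAd, mul_add, ← mul_assoc, h3, hAd]
    push_cast
    have h4 : (U.a U.m : ℝ) / (U.Λ - 1) = - (U.a U.m / (1 - U.Λ)) := by
      rw [← neg_sub, div_neg]
    have h5 : (U.a U.m : ℝ) = (U.a U.m / (1 - U.Λ)) * (1 - U.Λ) := by field_simp
    rw [h4]
    linear_combination h5
  rw [← hAd, ← hx]
  have hmom := fun i => U.drawProb_moment model hT i
  -- expansion of the left-hand side
  have hY : ∀ j, ∑ k ∈ range (U.m + 1), drawProb model U.m w v k *
      ((U.σ : ℝ) / U.m * k + A / (U.Λ - 1)) ^ j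
      = ∑ l ∈ range (j + 1), (w : ℝ) ^ l * ∑ i ∈ range (j + 1), (j.choose i : ℝ) *
          ((U.σ : ℝ) ^ i * A ^ (j - i) / ((U.m : ℝ) ^ i * (U.Λ - 1) ^ (j - i))) *
          U.sampleCoeff model (n + 1) i l := by
    intro j
    have h1 : ∀ k ∈ range (U.m + 1), drawProb model U.m w v k *
        ((U.σ : ℝ) / U.m * k + A / (U.Λ - 1)) ^ j
        = ∑ i ∈ range (j + 1), (j.choose i : ℝ) *
          ((U.σ : ℝ) ^ i * A ^ (j - i) / ((U.m : ℝ) ^ i * (U.Λ - 1) ^ (j - i))) *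
          (drawProb model U.m w v k * (k : ℝ) ^ i) := by
      intro k _
      rw [add_pow, mul_sum]
      refine sum_congr rfl fun i _ => ?_
      rw [mul_pow, div_pow, div_pow]
      field_simp
    rw [sum_congr rfl h1, sum_comm]
    simp only [← mul_sum, hmom]
    have h2 : ∀ i ∈ range (j + 1), ∑ l ∈ range (i + 1), U.sampleCoeff model (n + 1) i l *
        (w : ℝ) ^ l = ∑ l ∈ range (j + 1), U.sampleCoeff model (n + 1) i l * (w : ℝ) ^ l := by
      intro i hi
      refine sum_subset (range_subset_range.mpr (by have := mem_range.mp hi; omega)) fun l _ hl => ?_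
      rw [U.sampleCoeff_eq_zero model (by simpa using hl), zero_mul]
    rw [sum_congr rfl fun i hi => by rw [h2 i hi]]
    simp only [mul_sum]
    rw [sum_comm]
    exact sum_congr rfl fun l _ => sum_congr rfl fun i _ => by ring
  have hL : ∑ k ∈ range (U.m + 1), drawProb model U.m w v k *
        ((w : ℝ) + (U.a (U.m - k) : ℝ) - ((n + 1 : ℕ) : ℝ) * A / (1 - U.Λ)) ^ s
      = ∑ j ∈ range (s + 1), (s.choose j : ℝ) * U.Λ ^ j * x ^ (s - j) *
        ∑ k ∈ range (U.m + 1), drawProb model U.m w v k *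
          ((U.σ : ℝ) / U.m * k + A / (U.Λ - 1)) ^ j := by
    rw [sum_congr rfl fun k hk => by rw [hstep k hk, add_pow, mul_sum], sum_comm]
    refine sum_congr rfl fun j _ => ?_
    rw [mul_sum]
    refine sum_congr rfl fun k _ => ?_
    rw [mul_pow]; ring
  rw [hL]
  simp only [hY, f_succ, ← hAd, ← hc]
  -- comparison with the right-hand side
  have hR : ∀ j ∈ range (s + 1), ∀ l ∈ range (j + 1), x ^ (s - j) * (w : ℝ) ^ l
      = ∑ r ∈ Icc (s - j) s, (l.choose (j - (s - r)) : ℝ) * c ^ (l - (j - (s - r))) * x ^ r := by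
    intro j hj l hl
    have hj' : j ≤ s := by have := mem_range.mp hj; omega
    have hl' : l ≤ j := by have := mem_range.mp hl; omega
    rw [hw, add_pow, mul_sum]
    symm
    have h1 : Icc (s - j) s = (range (j + 1)).image (fun u => s - j + u) := by
      ext r
      simp only [mem_Icc, mem_image, mem_range]
      constructor
      · intro h; exact ⟨r - (s - j), by omega, by omega⟩
      · rintro ⟨u, hu, rfl⟩; omega
    rw [h1, sum_image (fun a _ b _ h => by simpa using h)]
    rw [← sum_subset (range_subset_range.mpr (Nat.succ_le_succ hl'))]
    · refine sum_congr rfl fun u hu => ?_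
      have hu' : u ≤ j := by have := mem_range.mp hu; omega
      rw [show j - (s - (s - j + u)) = u by omega, pow_add]; ring
    · intro u hu hu'
      simp only [mem_range] at hu hu'
      rw [show j - (s - (s - j + u)) = u by omega, Nat.choose_eq_zero_of_lt (by omega)]; simp
  have hswap : ∀ G : ℕ → ℕ → ℝ, ∑ r ∈ range (s + 1), ∑ j ∈ Icc (s - r) s, G r j
      = ∑ j ∈ range (s + 1), ∑ r ∈ Icc (s - j) s, G r j := by
    intro G
    refine sum_comm' fun r j => ?_
    simp only [mem_range, mem_Icc]; omega
  simp only [sum_mul]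
  rw [hswap]
  refine sum_congr rfl fun j hj => ?_
  rw [mul_sum]
  simp only [mul_sum _ _ ((s.choose j : ℝ) * U.Λ ^ j), sum_mul]
  rw [sum_comm]
  refine sum_congr rfl fun l hl => ?_
  calc _ = (s.choose j : ℝ) * U.Λ ^ j * (x ^ (s - j) * (w : ℝ) ^ l) *
        ∑ i ∈ range (j + 1), (j.choose i : ℝ) *
          ((U.σ : ℝ) ^ i * A ^ (j - i) / ((U.m : ℝ) ^ i * (U.Λ - 1) ^ (j - i))) *
          U.sampleCoeff model (n + 1) i l := by ring
    _ = _ := by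
      rw [hR j hj l hl]
      generalize ∑ i ∈ range (j + 1), (j.choose i : ℝ) *
          ((U.σ : ℝ) ^ i * A ^ (j - i) / ((U.m : ℝ) ^ i * (U.Λ - 1) ^ (j - i))) *
          U.sampleCoeff model (n + 1) i l = Z
      rw [mul_sum, sum_mul]
      exact sum_congr rfl fun r _ => by ring

variable {U model} {Ω : Type*} {X W B : ℕ → Ω → ℕ}

theorem drawsSigma_mono (X : ℕ → Ω → ℕ) (n : ℕ) : drawsSigma X n ≤ drawsSigma X (n + 1) :=
  iSup_le fun j => le_iSup (fun j : Fin (n + 1) => MeasurableSpace.comap (X j) ⊤) j.castSucc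

variable [MeasurableSpace Ω] {μ : Measure Ω}

theorem drawsSigma_le (hX : ∀ n, Measurable (X n)) (n : ℕ) :
    drawsSigma X n ≤ (inferInstance : MeasurableSpace Ω) :=
  iSup_le fun j => (hX j).comap_le

namespace IsEvolution

theorem measurable_white (hP : U.IsEvolution model μ X W B) (n : ℕ) :
    Measurable[drawsSigma X n] (W n) := by
  induction n with
  | zero =>
    have : W 0 = fun _ => U.W₀ := funext hP.white_zero
    rw [this]; exact measurable_const
  | succ n ih =>
    have h1 : Measurable[drawsSigma X (n + 1)] (W n) := ih.mono (drawsSigma_mono X n) le_rfl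
    have h2 : Measurable[drawsSigma X (n + 1)] (X n) :=
      Measurable.of_comap_le
        (le_iSup (fun j : Fin (n + 1) => MeasurableSpace.comap (X j) ⊤) (Fin.last n))
    -- By tenability the integer is a natural number, so `toNat` loses nothing.
    have h3 : W (n + 1) = (fun p : ℕ × ℕ => ((p.1 : ℤ) + U.a (U.m - p.2)).toNat) ∘
        fun ω => (W n ω, X n ω) := by
      ext ω
      simp [← hP.white_succ n ω]
    rw [h3]
    exact Measurable.of_discrete.comp (h1.prodMk h2)

theorem white_add_black (hP : U.IsEvolution model μ X W B) (n : ℕ) (ω : Ω) :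
    W n ω + B n ω = U.T n := by
  induction n with
  | zero => simp [hP.white_zero, hP.black_zero, T]
  | succ n ih =>
    have h1 := hP.white_succ n ω
    have h2 := hP.black_succ n ω
    have h3 := U.balanced (U.m - X n ω) (Nat.sub_le _ _)
    have h4 : U.T (n + 1) = U.T n + U.σ := by unfold T; ring
    omega

variable [IsProbabilityMeasure μ]

/-- The mean of a function of the number of white balls and of the next sample. -/
theorem integral_draw (hP : U.IsEvolution model μ X W B) (n : ℕ) (g : ℕ → ℕ → ℝ) :
    Integrable (fun ω => g (W n ω) (X n ω)) μ ∧
    ∫ ω, g (W n ω) (X n ω) ∂μ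
      = ∫ ω, ∑ k ∈ range (U.m + 1), drawProb model U.m (W n ω) (B n ω) k * g (W n ω) k ∂μ := by
  have hle := drawsSigma_le hP.measurable_draw n
  have hW := hP.measurable_white n
  -- The number of white balls lies in the finite set `{0, …, T_n}`, so every function of it is
  -- bounded.
  have hbd : ∀ k, ∃ c, ∀ ω, ‖g (W n ω) k‖ ≤ c := by
    intro k
    refine ⟨∑ w ∈ range (U.T n + 1), ‖g w k‖, fun ω => ?_⟩
    refine single_le_sum (f := fun w => ‖g w k‖) (fun w _ => norm_nonneg _) ?_
    have := hP.white_add_black n ω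
    simp only [mem_range]; omega
  have hg : ∀ k, StronglyMeasurable[drawsSigma X n] fun ω => g (W n ω) k := fun k =>
    ((Measurable.of_discrete (f := fun w => g w k)).comp hW).stronglyMeasurable
  have hind : ∀ k, Integrable ((X n ⁻¹' {k}).indicator fun _ => (1 : ℝ)) μ := fun k =>
    (integrable_const 1).indicator (hP.measurable_draw n (measurableSet_singleton k))
  have hint : ∀ k, Integrable ((fun ω => g (W n ω) k) *
      (X n ⁻¹' {k}).indicator fun _ => (1 : ℝ)) μ := by
    intro k
    obtain ⟨c, hc⟩ := hbd k
    exact (hind k).bdd_mul ((hg k).mono hle).aestronglyMeasurable (ae_of_all _ hc)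
  -- The content of the urn is known after `n` draws, so it can be taken out of the conditional
  -- expectation.
  have hce : ∀ k ≤ U.m, μ[(fun ω => g (W n ω) k) * (X n ⁻¹' {k}).indicator (fun _ => (1 : ℝ)) |
      drawsSigma X n] =ᵐ[μ] fun ω => drawProb model U.m (W n ω) (B n ω) k * g (W n ω) k := by
    intro k hk
    filter_upwards [condExp_mul_of_stronglyMeasurable_left (hg k) (hint k) (hind k),
      hP.condProb_draw n k hk] with ω h1 h2
    rw [h1, Pi.mul_apply, h2, mul_comm]
  have hsum : (fun ω => g (W n ω) (X n ω)) = fun ω => ∑ k ∈ range (U.m + 1),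
      ((fun ω => g (W n ω) k) * (X n ⁻¹' {k}).indicator fun _ => (1 : ℝ)) ω := by
    ext ω
    rw [sum_eq_single (X n ω)]
    · simp
    · intro k _ hk
      simp [Set.indicator, hk.symm]
    · intro h
      exact absurd (mem_range.mpr (Nat.lt_succ_of_le (hP.draw_le n ω))) h
  constructor
  · rw [hsum]; exact integrable_finsetSum _ fun k _ => hint k
  · rw [hsum, integral_finsetSum _ fun k _ => hint k, integral_finsetSum]
    · refine sum_congr rfl fun k hk => ?_
      rw [← integral_condExp hle]
      exact integral_congr_ae (hce k (by have := mem_range.mp hk; omega))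
    · intro k hk
      exact integrable_condExp.congr (hce k (by have := mem_range.mp hk; omega))

theorem integrable_shifted_pow (hP : U.IsEvolution model μ X W B) (n s : ℕ) :
    Integrable (fun ω => U.shifted W n ω ^ s) μ :=
  (hP.integral_draw n fun w _ => ((w : ℝ) - (n : ℝ) * (U.a U.m : ℝ) / (1 - U.Λ)) ^ s).1

theorem integral_shifted_zero_pow (hP : U.IsEvolution model μ X W B) (s : ℕ) :
    ∫ ω, U.shifted W 0 ω ^ s ∂μ = (U.W₀ : ℝ) ^ s := by
  simp [shifted, hP.white_zero]

/-- The recursion for the moments of the shifted variables. -/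
theorem integral_shifted_succ_pow (hA : U.IsAffine model) (hΛ : U.Λ ≠ 1)
    (hP : U.IsEvolution model μ X W B) (n s : ℕ) :
    ∫ ω, U.shifted W (n + 1) ω ^ s ∂μ
      = ∑ r ∈ range (s + 1), U.f model (n + 1) s r * ∫ ω, U.shifted W n ω ^ r ∂μ := by
  have h1 := (hP.integral_draw n fun w k => ((w : ℝ) + (U.a (U.m - k) : ℝ) -
    ((n + 1 : ℕ) : ℝ) * U.a U.m / (1 - U.Λ)) ^ s).2
  have h2 : ∀ ω, U.shifted W (n + 1) ω = (W n ω : ℝ) + (U.a (U.m - X n ω) : ℝ) -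
      ((n + 1 : ℕ) : ℝ) * U.a U.m / (1 - U.Λ) := by
    intro ω
    have : (W (n + 1) ω : ℝ) = (W n ω : ℝ) + (U.a (U.m - X n ω) : ℝ) := by
      exact_mod_cast hP.white_succ n ω
    rw [shifted, this]
  simp only [h2]
  rw [h1]
  simp only [fun ω => U.sum_drawProb_mul_shifted_pow model hA hΛ (hP.white_add_black n ω) s]
  rw [integral_finsetSum]
  · exact sum_congr rfl fun r _ => integral_const_mul _ _
  · exact fun r _ => (hP.integrable_shifted_pow n r).const_mul _

end IsEvolution

end UrnScheme

/-! ### Path expansion of the recursion -/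

namespace UrnScheme

variable (U : UrnScheme) (model : SamplingModel)

/-- For `r = s` the lower limit `j - (s - r)` equals `j`, so both inner sums collapse to `l = i = j`
and the shift drops out. -/
theorem f_diag_succ (n s : ℕ) :
    U.f model (n + 1) s s = ∑ j ∈ range (s + 1), (s.choose j : ℝ) * U.jumpConst ^ j *
      U.sampleCoeff model (n + 1) j j := by
  have h1 : Icc (s - s) s = range (s + 1) := by ext; simp
  rw [f, if_neg n.succ_ne_zero, h1]
  refine sum_congr rfl fun j _ => ?_
  rw [Nat.sub_self, Nat.sub_zero, Icc_self, sum_singleton, Icc_self, sum_singleton]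
  simp only [Nat.choose_self, Nat.sub_self, pow_zero, jumpConst, div_pow, mul_pow]
  push_cast; ring

theorem sampleCoeff_diag_nonneg (n j : ℕ) : 0 ≤ U.sampleCoeff model n j j := by
  cases model with
  | M =>
    simp only [sampleCoeff]
    refine sum_nonneg fun h hh => ?_
    rw [show h - j = 0 by simp only [mem_Icc, le_min_iff] at hh; omega]
    positivity
  | R => simp only [sampleCoeff]; positivity

theorem sampleCoeff_zero_zero (n : ℕ) : U.sampleCoeff model n 0 0 = 1 := by
  cases model <;> simp [sampleCoeff]

variable {U} in
theorem IsLargeIndex.jumpConst_pos (hL : U.IsLargeIndex) : 0 < U.jumpConst := by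
  have h1 : 0 < U.Λ := by have := hL.2.1; linarith
  have h2 : (0 : ℝ) < U.m := by exact_mod_cast U.one_le_m
  have h3 : (0 : ℝ) < U.σ := by exact_mod_cast U.one_le_σ
  unfold jumpConst; positivity

variable {U} in
-- The term `j = 0` equals `1`, and the others are nonnegative because `C > 0`. This makes all
-- divisions by diagonal products legitimate.
theorem IsLargeIndex.one_le_f_diag (hL : U.IsLargeIndex) (n s : ℕ) : 1 ≤ U.f model n s s := by
  rcases n with _ | n
  · simp [f]
  rw [f_diag_succ]
  have h := single_le_sum (s := range (s + 1)) (f := fun j => (s.choose j : ℝ) * U.jumpConst ^ j *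
      U.sampleCoeff model (n + 1) j j) (fun j _ => mul_nonneg (mul_nonneg (Nat.cast_nonneg _)
        (pow_nonneg hL.jumpConst_pos.le _)) (U.sampleCoeff_diag_nonneg model _ _))
        (mem_range.mpr s.succ_pos)
  simpa [sampleCoeff_zero_zero] using h

theorem f_zero_zero (n : ℕ) : U.f model n 0 0 = 1 := by
  rcases n with _ | n
  · simp [f]
  · rw [f_diag_succ]; simp [sampleCoeff_zero_zero]

/-- The product `∏_{j=1}^n f_{j,s,s}`. -/
noncomputable def diagProd (n s : ℕ) : ℝ := ∏ j ∈ Icc 1 n, U.f model j s s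

theorem diagProd_zero_left (s : ℕ) : U.diagProd model 0 s = 1 := by simp [diagProd]

theorem diagProd_zero_right (n : ℕ) : U.diagProd model n 0 = 1 := by
  simp [diagProd, f_zero_zero]

theorem diagProd_succ (n s : ℕ) :
    U.diagProd model (n + 1) s = U.diagProd model n s * U.f model (n + 1) s s := by
  rw [diagProd, prod_Icc_succ_top (by omega)]; rfl

theorem diagProd_mul_prod {i n : ℕ} (h : i ≤ n) (s : ℕ) :
    U.diagProd model i s * ∏ j ∈ Icc (i + 1) n, U.f model j s s = U.diagProd model n s := by
  induction n, h using Nat.le_induction with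
  | base => simp
  | succ n hn ih => rw [prod_Icc_succ_top (by omega), ← mul_assoc, ih, diagProd_succ]

variable {U} in
theorem IsLargeIndex.one_le_diagProd (hL : U.IsLargeIndex) (n s : ℕ) :
    1 ≤ U.diagProd model n s := by
  induction n with
  | zero => rw [diagProd_zero_left]
  | succ n ih =>
    rw [diagProd_succ]; exact one_le_mul_of_one_le_of_one_le ih (hL.one_le_f_diag model _ _)

variable {U} in
theorem IsLargeIndex.diagProd_ne_zero (hL : U.IsLargeIndex) (n s : ℕ) :
    U.diagProd model n s ≠ 0 :=
  (zero_lt_one.trans_le (hL.one_le_diagProd model n s)).ne'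

/-- The normalized weight of a jump from level `s` to level `r` at time `i`. -/
noncomputable def jumpWeight (s r i : ℕ) : ℝ :=
  U.f model i s r * U.diagProd model (i - 1) r / U.diagProd model i s

/-- The product of the normalized weights of the jumps of a path. -/
noncomputable def jumpProd {r : ℕ} (s : ℕ) (h i : Fin r → ℕ) : ℝ :=
  ∏ g : Fin r, U.jumpWeight model (s - height s h g) (s - height s h (g + 1)) (i g)

/-- The normalized weight of the last jump to level `0`, if there is one. -/
noncomputable def sinkWeight (l q : ℕ) : ℝ := if q = 0 then 1 else U.jumpWeight model l 0 q

section
variable {r : ℕ} {n q : ℕ} {i : Fin r → ℕ}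

theorem jumpTime_zero (n q : ℕ) (i : Fin r → ℕ) : jumpTime n q i 0 = n := by simp [jumpTime]

theorem jumpTime_succ (n q : ℕ) (i : Fin r → ℕ) (g : Fin r) :
    jumpTime n q i (g + 1) = i g := by
  simp [jumpTime]

theorem jumpTime_last (n q : ℕ) (i : Fin r → ℕ) : jumpTime n q i (r + 1) = q := by
  simp [jumpTime]

/-- The added end points `n + 1` and `q` keep the times strictly decreasing; only then are the
products between two jumps quotients of diagonal products. -/
theorem jumpTime_lt (hi : StrictAnti i) (hn : ∀ g, i g ≤ n) (hq : ∀ g, q + 1 ≤ i g) (hqn : q ≤ n)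
    {g : ℕ} (hg : g ≤ r) : jumpTime (n + 1) q i (g + 1) < jumpTime (n + 1) q i g := by
  rcases hg.eq_or_lt with rfl | hg
  · rw [jumpTime_last]
    rcases g with _ | g
    · rw [jumpTime_zero]; omega
    · have := jumpTime_succ (n + 1) q i (Fin.last g)
      rw [Fin.val_last] at this
      rw [this]; exact hq _
  · have h1 := jumpTime_succ (n + 1) q i ⟨g, hg⟩
    rw [h1]
    rcases g with _ | g
    · rw [jumpTime_zero]; exact Nat.lt_succ_of_le (hn _)
    · have h2 := jumpTime_succ (n + 1) q i ⟨g, by omega⟩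
      rw [h2]
      exact hi (by simp [Fin.lt_def])

theorem height_zero (s : ℕ) (h : Fin r → ℕ) : height s h 0 = 0 := by simp [height]

theorem height_last (s : ℕ) (h : Fin r → ℕ) : height s h r = ∑ ν, h ν := by
  rw [height, if_pos le_rfl]
  exact sum_congr rfl fun ν _ => if_pos ν.2

theorem height_sink (s : ℕ) (h : Fin r → ℕ) : height s h (r + 1) = s := by simp [height]

variable {U} in
theorem IsLargeIndex.prod_Icc_f (hL : U.IsLargeIndex) {i n : ℕ} (h : i < n) (s : ℕ) :
    ∏ j ∈ Icc (i + 1) (n - 1), U.f model j s s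
      = U.diagProd model (n - 1) s / U.diagProd model i s := by
  rw [eq_div_iff (hL.diagProd_ne_zero model _ _), mul_comm]
  exact U.diagProd_mul_prod model (by omega) s

variable {U} in
/-- The weight of a path is the product of the normalized weights of its jumps, up to a factor
that depends on the starting point only. -/
theorem IsLargeIndex.pathWeight_eq (hL : U.IsLargeIndex) (s : ℕ) (h : Fin r → ℕ)
    (hi : StrictAnti i) (hn : ∀ g, i g ≤ n) (hq : ∀ g, q + 1 ≤ i g) (hqn : q ≤ n) :
    U.pathWeight model n s q h i = U.diagProd model n s *
      (U.jumpProd model s h i * U.sinkWeight model (s - ∑ ν, h ν) q) := by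
  -- Each path factor is a jump weight times `a g / a (g + 1)`; these quotients telescope, starting
  -- from `a 0 = D_{n,s}`.
  obtain ⟨a, ha⟩ : ∃ a : ℕ → ℝ, ∀ g, a g = U.diagProd model (jumpTime (n + 1) q i g - 1)
    (s - height s h g) := ⟨_, fun _ => rfl⟩
  have hlt := fun g hg => jumpTime_lt hi hn hq hqn (g := g) hg
  have ha0 : ∀ g, a g ≠ 0 := fun g => by rw [ha]; exact hL.diagProd_ne_zero model _ _
  have hfac : ∀ g, ∀ hg : g < r, U.pathFactor model s (n + 1) q h i (g + 1)
      = U.jumpWeight model (s - height s h g) (s - height s h (g + 1)) (i ⟨g, hg⟩) *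
        (a g / a (g + 1)) := by
    intro g hg
    have h1 := jumpTime_succ (n + 1) q i ⟨g, hg⟩
    have h2 := ha0 (g + 1)
    rw [ha, h1] at h2
    rw [pathFactor, Nat.add_sub_cancel, hL.prod_Icc_f model (hlt g hg.le), jumpWeight, ha, ha, h1]
    have h3 := hL.diagProd_ne_zero model (i ⟨g, hg⟩) (s - height s h g)
    field_simp
  have hprod : ∀ g (hg : g ≤ r), ∏ x ∈ range g, U.pathFactor model s (n + 1) q h i (x + 1)
      = (∏ x : Fin g, U.jumpWeight model (s - height s h x) (s - height s h (x + 1))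
        (i ⟨x, x.2.trans_le hg⟩)) * (a 0 / a g) := by
    intro g
    induction g with
    | zero => intro _; simp [ha0]
    | succ g ih =>
      intro hg
      rw [prod_range_succ, ih (by omega), hfac g (by omega), Fin.prod_univ_castSucc]
      have h1 := ha0 g
      have h2 := ha0 (g + 1)
      simp only [Fin.val_castSucc, Fin.val_last]
      field_simp
  -- For `q = 0` there is no jump: both `f_{0,·,·}` and the empty diagonal product are `1`. For `q ≥
  -- 1` it is a jump to level `0`, whose diagonal products are `1`.
  have hlast : U.pathFactor model s (n + 1) q h i (r + 1)
      = a r * U.sinkWeight model (s - ∑ ν, h ν) q := by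
    rw [pathFactor, Nat.add_sub_cancel, jumpTime_last, height_sink, Nat.sub_self]
    have h1 := hlt r le_rfl
    rw [jumpTime_last] at h1
    rw [hL.prod_Icc_f model h1, ha, sinkWeight, height_last]
    split_ifs with hq0
    · simp [hq0, f, diagProd_zero_left]
    · rw [jumpWeight, diagProd_zero_right]; ring
  have hIcc : ∏ g ∈ Icc 1 (r + 1), U.pathFactor model s (n + 1) q h i g
      = ∏ x ∈ range (r + 1), U.pathFactor model s (n + 1) q h i (x + 1) := by
    rw [range_eq_Ico, prod_Ico_add' (fun g => U.pathFactor model s (n + 1) q h i g) 0 (r + 1) 1]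
    rfl
  have h0 : a 0 = U.diagProd model n s := by
    rw [ha, jumpTime_zero, height_zero]; rfl
  rw [pathWeight, hIcc, prod_range_succ, hprod r le_rfl, hlast, h0, jumpProd]
  have := ha0 r
  field_simp

variable {U} in
/-- The weight of a path divided by the diagonal product. -/
theorem IsLargeIndex.pathWeight_eq_limitWeight (hL : U.IsLargeIndex) (s : ℕ) (h : Fin r → ℕ)
    (hi : StrictAnti i) (hn : ∀ g, i g ≤ n) (hq : ∀ g, q + 1 ≤ i g) (hqn : q ≤ n) :
    U.pathWeight model n s q h i = U.diagProd model n s * U.limitWeight model s q h i := by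
  -- The top time is seen only at index `0`, hence only the factor `g = 1` depends on `n`.
  have h1 : ∀ t g, 1 ≤ g → jumpTime t q i g = jumpTime 0 q i g := by
    intro t g hg; simp [jumpTime, show g ≠ 0 by omega]
  have h2 : ∀ g ∈ Icc 2 (r + 1), U.pathFactor model s (n + 1) q h i g
      = U.pathFactor model s 0 q h i g := by
    intro g hg
    have hg' := (mem_Icc.mp hg).1
    rw [pathFactor, pathFactor, h1 _ g (by omega), h1 _ (g - 1) (by omega)]
  have h3 : Icc 1 (r + 1) = insert 1 (Icc 2 (r + 1)) := by
    ext; simp only [mem_Icc, mem_insert]; omega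
  have h4 := jumpTime_lt hi hn hq hqn (Nat.zero_le r)
  rw [jumpTime_zero] at h4
  have h5 := hL.diagProd_ne_zero model (jumpTime 0 q i 1) s
  rw [pathWeight, limitWeight, h3, prod_insert (by simp), prod_congr rfl h2, pathFactor,
    Nat.sub_self, jumpTime_zero, height_zero, Nat.sub_zero, hL.prod_Icc_f model h4,
    Nat.add_sub_cancel, h1 (n + 1) (0 + 1) le_rfl, zero_add]
  change _ = U.diagProd model n s * (_ / U.diagProd model _ s)
  field_simp

variable {U} in
-- For any `n` beyond all the times, the two expressions for `pathWeight` can be compared and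
-- `D_{n,s}` cancelled.
theorem IsLargeIndex.limitWeight_eq (hL : U.IsLargeIndex) (s : ℕ) (h : Fin r → ℕ)
    (hi : StrictAnti i) (hq : ∀ g, q + 1 ≤ i g) :
    U.limitWeight model s q h i
      = U.jumpProd model s h i * U.sinkWeight model (s - ∑ ν, h ν) q := by
  obtain ⟨n, hn, hqn⟩ : ∃ n, (∀ g, i g ≤ n) ∧ q ≤ n :=
    ⟨q + ∑ g, i g, fun g => (single_le_sum (f := i) (fun _ _ => Nat.zero_le _) (mem_univ g)).trans
      (Nat.le_add_left _ _), Nat.le_add_right _ _⟩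
  have h1 := hL.pathWeight_eq model s h hi hn hq hqn
  rw [hL.pathWeight_eq_limitWeight model s h hi hn hq hqn] at h1
  exact mul_left_cancel₀ (hL.diagProd_ne_zero model n s) h1

end

/-- The first argument of `height` matters only at the sink index, so `t` is free; it becomes the
starting level `s - h₀` of the remaining path. -/
theorem height_cons_succ {r s t h₀ g : ℕ} (h : Fin r → ℕ) (hg : g ≤ r) :
    height s (Fin.cons h₀ h : Fin (r + 1) → ℕ) (g + 1) = h₀ + height t h g := by
  rw [height, if_pos (by omega), height, if_pos hg, Fin.sum_univ_succ]
  simp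

theorem jumpProd_cons {r : ℕ} (s h₀ i₀ : ℕ) (h i : Fin r → ℕ) :
    U.jumpProd model s (Fin.cons h₀ h : Fin (r + 1) → ℕ) (Fin.cons i₀ i)
      = U.jumpWeight model s (s - h₀) i₀ * U.jumpProd model (s - h₀) h i := by
  rw [jumpProd, jumpProd, Fin.prod_univ_succ]
  congr 1
  · rw [Fin.val_zero, height_zero, height_cons_succ (t := s) h (Nat.zero_le r), height_zero]
    simp
  · refine prod_congr rfl fun g _ => ?_
    rw [Fin.val_succ, height_cons_succ (t := s - h₀) h g.2.le,
      height_cons_succ (t := s - h₀) h g.2, Fin.cons_succ, Nat.sub_sub, Nat.sub_sub]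

theorem mem_jumpHeights {r d : ℕ} {h : Fin r → ℕ} :
    h ∈ jumpHeights r d ↔ (∀ ν, 1 ≤ h ν) ∧ ∑ ν, h ν = d := by
  simp only [jumpHeights, mem_filter, Fintype.mem_piFinset, mem_Icc]
  constructor
  · exact fun H => ⟨fun ν => (H.1 ν).1, H.2⟩
  · refine fun H => ⟨fun ν => ⟨H.1 ν, ?_⟩, H.2⟩
    rw [← H.2]; exact single_le_sum (f := h) (fun _ _ => Nat.zero_le _) (mem_univ ν)

theorem mem_jumpTimes {n r q : ℕ} {i : Fin r → ℕ} :
    i ∈ jumpTimes n r q ↔ StrictAnti i ∧ (∀ g, i g ≤ n) ∧ ∀ g, q + 1 ≤ i g := by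
  simp only [jumpTimes, mem_filter, Fintype.mem_piFinset, mem_Icc]
  exact ⟨fun H => ⟨H.2, fun g => (H.1 g).2, fun g => (H.1 g).1⟩,
    fun H => ⟨fun g => ⟨H.2.2 g, H.2.1 g⟩, H.1⟩⟩

theorem strictAnti_cons {r i₀ : ℕ} {i : Fin r → ℕ} :
    StrictAnti (Fin.cons i₀ i : Fin (r + 1) → ℕ) ↔ (∀ g, i g < i₀) ∧ StrictAnti i := by
  constructor
  · intro H
    refine ⟨fun g => ?_, fun a b hab => ?_⟩
    · simpa using H (Fin.succ_pos g)
    · simpa using H (Fin.succ_lt_succ_iff.mpr hab)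
  · rintro ⟨h1, h2⟩ a b hab
    induction b using Fin.cases with
    | zero => exact absurd hab (Fin.not_lt_zero a)
    | succ b =>
      induction a using Fin.cases with
      | zero => simpa using h1 b
      | succ a => simpa using h2 (Fin.succ_lt_succ_iff.mp hab)

theorem sum_jumpHeights_succ (r d : ℕ) (G : (Fin (r + 1) → ℕ) → ℝ) :
    ∑ h ∈ jumpHeights (r + 1) d, G h
      = ∑ h₀ ∈ Icc 1 d, ∑ h ∈ jumpHeights r (d - h₀), G (Fin.cons h₀ h) := by
  rw [sum_sigma']
  refine sum_nbij' (fun h => ⟨h 0, Fin.tail h⟩) (fun x => Fin.cons x.1 x.2) ?_ ?_ ?_ ?_ ?_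
  · intro h hh
    rw [mem_jumpHeights, Fin.sum_univ_succ] at hh
    simp only [mem_sigma, mem_Icc, mem_jumpHeights]
    refine ⟨⟨hh.1 0, by omega⟩, fun ν => hh.1 ν.succ, ?_⟩
    simp only [Fin.tail]; omega
  · rintro ⟨h₀, h⟩ hh
    simp only [mem_sigma, mem_Icc, mem_jumpHeights] at hh
    rw [mem_jumpHeights, Fin.sum_univ_succ]
    simp only [Fin.forall_fin_succ, Fin.cons_zero, Fin.cons_succ]
    exact ⟨⟨hh.1.1, hh.2.1⟩, by omega⟩
  · intro h _; simp
  · intro x _; simp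
  · intro h _; simp

theorem sum_jumpTimes_succ (n r q : ℕ) (G : (Fin (r + 1) → ℕ) → ℝ) :
    ∑ i ∈ jumpTimes n (r + 1) q, G i
      = ∑ i₀ ∈ Icc (q + 1) n, ∑ i ∈ jumpTimes (i₀ - 1) r q, G (Fin.cons i₀ i) := by
  rw [sum_sigma']
  refine sum_nbij' (fun h => ⟨h 0, Fin.tail h⟩) (fun x => Fin.cons x.1 x.2) ?_ ?_ ?_ ?_ ?_
  · intro i hi
    rw [mem_jumpTimes, ← Fin.cons_self_tail i, strictAnti_cons] at hi
    simp only [mem_sigma, mem_Icc, mem_jumpTimes]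
    simp only [Fin.forall_fin_succ, Fin.cons_zero, Fin.cons_succ] at hi
    exact ⟨⟨hi.2.2.1, hi.2.1.1⟩, hi.1.2, fun g => Nat.le_sub_one_of_lt (hi.1.1 g), hi.2.2.2⟩
  · rintro ⟨i₀, i⟩ hi
    simp only [mem_sigma, mem_Icc, mem_jumpTimes] at hi
    rw [mem_jumpTimes, strictAnti_cons]
    simp only [Fin.forall_fin_succ, Fin.cons_zero, Fin.cons_succ]
    have h1 : ∀ g, i g < i₀ := fun g => by have := hi.2.2.1 g; omega
    exact ⟨⟨h1, hi.2.1⟩, ⟨hi.1.2, fun g => (h1 g).le.trans hi.1.2⟩, hi.1.1, hi.2.2.2⟩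
  · intro h _; simp
  · intro x _; simp
  · intro h _; simp

theorem jumpHeights_eq_empty {r d : ℕ} (h : d < r) : jumpHeights r d = ∅ := by
  refine eq_empty_of_forall_notMem fun x hx => ?_
  rw [mem_jumpHeights] at hx
  have := Finset.sum_le_sum fun ν (_ : ν ∈ (univ : Finset (Fin r))) => hx.1 ν
  simp at this; omega

/-- The sum of the normalized weights of the paths with `r` jumps. -/
noncomputable def jumpSum (q r n s d : ℕ) : ℝ :=
  ∑ h ∈ jumpHeights r d, ∑ i ∈ jumpTimes n r q, U.jumpProd model s h i

theorem jumpSum_zero (q n s d : ℕ) : U.jumpSum model q 0 n s d = if d = 0 then 1 else 0 := by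
  have h1 : jumpTimes n 0 q = univ := by
    exact eq_univ_of_forall fun i => by simp [mem_jumpTimes, Subsingleton.strictAnti]
  rcases d with _ | d
  · have h2 : jumpHeights 0 0 = univ :=
      eq_univ_of_forall fun i => by simp [mem_jumpHeights]
    simp [jumpSum, h1, h2, jumpProd]
  · have h2 : jumpHeights 0 (d + 1) = ∅ := by ext; simp [mem_jumpHeights]
    simp [jumpSum, h2]

theorem jumpSum_succ (q r n s d : ℕ) :
    U.jumpSum model q (r + 1) n s d = ∑ i₀ ∈ Icc (q + 1) n, ∑ h₀ ∈ Icc 1 d,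
      U.jumpWeight model s (s - h₀) i₀ * U.jumpSum model q r (i₀ - 1) (s - h₀) (d - h₀) := by
  simp only [jumpSum, sum_jumpHeights_succ, sum_jumpTimes_succ, jumpProd_cons, mul_sum]
  rw [sum_comm]
  exact sum_congr rfl fun h₀ _ => sum_comm

theorem jumpSum_eq_zero {q r n s d : ℕ} (h : d < r) : U.jumpSum model q r n s d = 0 := by
  rw [jumpSum, jumpHeights_eq_empty h, sum_empty]

/-- The sum of the normalized weights of the paths from level `s` to level `l` with jumps at times
in `(q, n]`. -/
noncomputable def pathSum (q n s l : ℕ) : ℝ :=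
  ∑ r ∈ range (s - l + 1), U.jumpSum model q r n s (s - l)

/-- Either there is no jump, or the first (latest) jump leads to some level `r` at some time `i`,
followed by a path from `r` to `l` with times below `i`. -/
theorem pathSum_eq {q n s l : ℕ} (hl : l ≤ s) :
    U.pathSum model q n s l = (if s = l then 1 else 0) +
      ∑ i ∈ Icc (q + 1) n, ∑ r ∈ Ico l s,
        U.jumpWeight model s r i * U.pathSum model q (i - 1) r l := by
  rw [pathSum, sum_range_succ', jumpSum_zero, add_comm]
  congr 1
  · simp only [show s - l = 0 ↔ s = l by omega]
  simp only [jumpSum_succ]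
  rw [sum_comm]
  refine sum_congr rfl fun i _ => ?_
  rw [sum_comm]
  simp only [← mul_sum]
  refine sum_nbij' (fun h => s - h) (fun r => s - r) ?_ ?_ ?_ ?_ ?_
  · intro h hh; simp only [mem_Icc, mem_Ico] at hh ⊢; omega
  · intro h hh; simp only [mem_Icc, mem_Ico] at hh ⊢; omega
  · intro h hh; simp only [mem_Icc] at hh; omega
  · intro h hh; simp only [mem_Ico] at hh; omega
  · intro h hh
    rw [mem_Icc] at hh
    rw [pathSum, show s - h - l = s - l - h by omega]
    congr 1
    symm
    -- Heights are at least `1`, so no path has more jumps than the distance of its levels; the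
    -- larger range of jump numbers adds only zeros.
    refine sum_subset (range_subset_range.mpr (by omega)) fun r _ hr => ?_
    exact U.jumpSum_eq_zero model (by simpa using hr)

theorem pathSum_of_le {q n s l : ℕ} (hl : l ≤ s) (hq : n ≤ q) :
    U.pathSum model q n s l = if s = l then 1 else 0 := by
  rw [U.pathSum_eq model hl, Icc_eq_empty (by omega), sum_empty, add_zero]

theorem pathSum_succ {q n s l : ℕ} (hl : l ≤ s) (hq : q ≤ n) :
    U.pathSum model q (n + 1) s l = U.pathSum model q n s l +
      ∑ r ∈ Ico l s, U.jumpWeight model s r (n + 1) * U.pathSum model q n r l := by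
  rw [U.pathSum_eq model hl, sum_Icc_succ_top (by omega), ← add_assoc, ← U.pathSum_eq model hl,
    Nat.add_sub_cancel]

variable {U} in
theorem IsLargeIndex.phi_div_of_pos (hL : U.IsLargeIndex) {n s k : ℕ} (hk : 1 ≤ k) (hks : k ≤ s) :
    U.phi model n s k / U.diagProd model n s = U.pathSum model 0 n s k := by
  have h0 := hL.diagProd_ne_zero model n s
  rcases hks.eq_or_lt with rfl | hks
  · rw [phi, if_pos rfl]
    change U.diagProd model n k / _ = _
    rw [div_self h0, pathSum, Nat.sub_self, zero_add, sum_range_one, jumpSum_zero, if_pos rfl]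
  · rw [phi, if_neg hks.ne, if_neg (by omega), div_eq_iff h0, pathSum, sum_range_succ', jumpSum_zero,
      if_neg (by omega), add_zero, sum_mul, range_eq_Ico,
      sum_Ico_add' (fun r => U.jumpSum model 0 r n s (s - k) * U.diagProd model n s) 0 (s - k) 1]
    change _ = ∑ r ∈ Icc 1 (s - k), _
    refine sum_congr rfl fun r _ => ?_
    rw [jumpSum, sum_mul]
    refine sum_congr rfl fun h _ => ?_
    rw [sum_mul]
    refine sum_congr rfl fun i hi => ?_
    rw [mem_jumpTimes] at hi
    rw [hL.pathWeight_eq model s h hi.1 hi.2.1 hi.2.2 (Nat.zero_le _), sinkWeight, if_pos rfl,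
      mul_one, mul_comm]

variable {U} in
-- A path to level `0` is cut at its last jump, from level `l` at time `q`; the part before it is a
-- path from `s` to `l` with times above `q`.
theorem IsLargeIndex.phi_div_zero (hL : U.IsLargeIndex) {n s : ℕ} (hs : 1 ≤ s) :
    U.phi model n s 0 / U.diagProd model n s
      = ∑ q ∈ Icc 1 n, ∑ l ∈ Icc 1 s, U.pathSum model q n s l * U.jumpWeight model l 0 q := by
  have h0 := hL.diagProd_ne_zero model n s
  rw [phi, if_neg (by omega), if_pos rfl, div_eq_iff h0, sum_mul]
  refine sum_congr rfl fun q hq => ?_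
  rw [sum_mul]
  refine sum_congr rfl fun l hl => ?_
  rw [mem_Icc] at hq hl
  rw [pathSum, sum_mul, sum_mul]
  have h1 : Icc 0 (s - l) = range (s - l + 1) := by ext; simp
  rw [h1]
  refine sum_congr rfl fun r _ => ?_
  rw [jumpSum, sum_mul, sum_mul]
  refine sum_congr rfl fun h hh => ?_
  rw [sum_mul, sum_mul]
  refine sum_congr rfl fun i hi => ?_
  rw [mem_jumpTimes] at hi
  rw [mem_jumpHeights] at hh
  rw [hL.pathWeight_eq model s h hi.1 hi.2.1 hi.2.2 hq.2, sinkWeight, if_neg (by omega), hh.2,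
    Nat.sub_sub_self hl.2]
  ring

variable {U} in
/-- The recursion for the normalized coefficients. -/
theorem IsLargeIndex.phi_div_succ (hL : U.IsLargeIndex) {n s k : ℕ} (hks : k ≤ s) :
    U.phi model (n + 1) s k / U.diagProd model (n + 1) s
      = U.phi model n s k / U.diagProd model n s + ∑ r ∈ Ico k s,
        U.jumpWeight model s r (n + 1) * (U.phi model n r k / U.diagProd model n r) := by
  have hdiag : ∀ n s, U.phi model n s s / U.diagProd model n s = 1 := fun n s => by
    rw [phi, if_pos rfl]; exact div_self (hL.diagProd_ne_zero model n s)
  rcases Nat.eq_zero_or_pos k with rfl | hk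
  · rcases Nat.eq_zero_or_pos s with rfl | hs
    · simp [hdiag]
    · rw [hL.phi_div_zero model hs, hL.phi_div_zero model hs, sum_Icc_succ_top (by omega),
        sum_eq_sum_Ico_succ_bot hs, hdiag, mul_one]
      -- The new value `q = n + 1` leaves no room for earlier jumps: this is the direct jump from
      -- `s` to `0`, the term `r = 0` of the recursion.
      have h1 : ∑ l ∈ Icc 1 s, U.pathSum model (n + 1) (n + 1) s l * U.jumpWeight model l 0 (n + 1)
          = U.jumpWeight model s 0 (n + 1) := by
        rw [sum_eq_single s]
        · rw [U.pathSum_of_le model le_rfl le_rfl, if_pos rfl, one_mul]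
        · intro l hl hls
          rw [U.pathSum_of_le model (mem_Icc.mp hl).2 le_rfl, if_neg hls.symm, zero_mul]
        · intro h; exact absurd (mem_Icc.mpr ⟨hs, le_rfl⟩) h
      have h2 : ∀ q ∈ Icc 1 n, ∑ l ∈ Icc 1 s, U.pathSum model q (n + 1) s l *
          U.jumpWeight model l 0 q
          = ∑ l ∈ Icc 1 s, U.pathSum model q n s l * U.jumpWeight model l 0 q
            + ∑ r ∈ Ico 1 s, U.jumpWeight model s r (n + 1) *
              ∑ l ∈ Icc 1 r, U.pathSum model q n r l * U.jumpWeight model l 0 q := by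
        intro q hq
        simp only [mul_sum]
        rw [sum_comm' (t' := Icc 1 s) (s' := fun l => Ico l s)
          (h := fun r l => by simp only [mem_Ico, mem_Icc]; omega), ← sum_add_distrib]
        refine sum_congr rfl fun l hl => ?_
        rw [U.pathSum_succ model (mem_Icc.mp hl).2 (mem_Icc.mp hq).2, add_mul, sum_mul]
        congr 1
        exact sum_congr rfl fun r _ => by ring
      rw [h1, sum_congr rfl h2, sum_add_distrib, sum_comm (s := Icc 1 n) (t := Ico 1 s)]
      simp only [← mul_sum]
      have h3 : ∀ r ∈ Ico 1 s, U.jumpWeight model s r (n + 1) * ∑ q ∈ Icc 1 n, ∑ l ∈ Icc 1 r,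
          U.pathSum model q n r l * U.jumpWeight model l 0 q
          = U.jumpWeight model s r (n + 1) * (U.phi model n r 0 / U.diagProd model n r) :=
        fun r hr => by rw [hL.phi_div_zero model (mem_Ico.mp hr).1]
      rw [sum_congr rfl h3, zero_add]
      ring
  · rw [hL.phi_div_of_pos model hk hks, hL.phi_div_of_pos model hk hks,
      U.pathSum_succ model hks (Nat.zero_le n)]
    congr 1
    refine sum_congr rfl fun r hr => ?_
    rw [hL.phi_div_of_pos model hk (mem_Ico.mp hr).1]

theorem phi_div_zero_left {s k : ℕ} (hks : k ≤ s) :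
    U.phi model 0 s k / U.diagProd model 0 s = if s = k then 1 else 0 := by
  rw [diagProd_zero_left, div_one, phi]
  rcases eq_or_ne k s with rfl | h1
  · simp
  rw [if_neg h1, if_neg h1.symm]
  split_ifs
  · simp
  · refine sum_eq_zero fun r hr => sum_eq_zero fun h _ => ?_
    rw [mem_Icc] at hr
    obtain ⟨r, rfl⟩ := Nat.exists_eq_add_of_le' hr.1
    rw [sum_jumpTimes_succ]; simp

variable {U model} {Ω : Type*} [MeasurableSpace Ω] {μ : Measure Ω} [IsProbabilityMeasure μ]
  {X W B : ℕ → Ω → ℕ}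

/-- The moments of the shifted variables. -/
theorem IsEvolution.integral_shifted_pow (hA : U.IsAffine model) (hL : U.IsLargeIndex)
    (hP : U.IsEvolution model μ X W B) (n s : ℕ) :
    ∫ ω, U.shifted W n ω ^ s ∂μ
      = U.diagProd model n s * ∑ k ∈ range (s + 1),
        U.phi model n s k / U.diagProd model n s * (U.W₀ : ℝ) ^ k := by
  induction n generalizing s with
  | zero =>
    rw [hP.integral_shifted_zero_pow, sum_eq_single s]
    · rw [U.phi_div_zero_left model le_rfl, if_pos rfl, diagProd_zero_left, one_mul, one_mul]
    · intro k hk hks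
      rw [U.phi_div_zero_left model (by simpa [Nat.lt_succ_iff] using hk), if_neg hks.symm, zero_mul]
    · simp
  | succ n ih =>
    have hd := hL.diagProd_ne_zero model (n + 1) s
    -- Summed over `k`, this is the moment recursion divided by `D_{n+1,s}`.
    have hk : ∀ k ∈ range (s + 1), U.phi model (n + 1) s k / U.diagProd model (n + 1) s *
        (U.W₀ : ℝ) ^ k = U.phi model n s k / U.diagProd model n s * (U.W₀ : ℝ) ^ k +
        ∑ r ∈ Ico k s, U.jumpWeight model s r (n + 1) *
          (U.phi model n r k / U.diagProd model n r * (U.W₀ : ℝ) ^ k) := by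
      intro k hk
      rw [hL.phi_div_succ model (by simpa [Nat.lt_succ_iff] using hk), add_mul, sum_mul]
      congr 1
      exact sum_congr rfl fun r _ => by ring
    rw [hP.integral_shifted_succ_pow hA hL.2.2.ne, sum_congr rfl hk, sum_add_distrib,
      sum_comm' (t' := range s) (s' := fun r => range (r + 1))
        (h := fun k r => by simp only [mem_Ico, mem_range]; omega), sum_range_succ, ih s, add_comm,
      mul_add, ← mul_assoc, diagProd_succ, mul_comm (U.f model (n + 1) s s)]
    congr 1
    rw [mul_sum]
    refine sum_congr rfl fun r _ => ?_
    rw [ih r, ← mul_sum, jumpWeight, Nat.add_sub_cancel, ← diagProd_succ]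
    field_simp

end UrnScheme

/-! ### Products of rational functions and the Gamma function -/

theorem prod_GammaSeq_mul_prod (A : Multiset ℂ) (hA : ∀ a ∈ A, ∀ j : ℕ, a + j ≠ 0)
    {n : ℕ} (hn : n ≠ 0) :
    (A.map fun a => Complex.GammaSeq a n).prod *
        ∏ j ∈ range (n + 1), (A.map fun a => a + (j : ℂ)).prod
      = (n : ℂ) ^ A.sum * (n.factorial : ℂ) ^ A.card := by
  have hn' : (n : ℂ) ≠ 0 := Nat.cast_ne_zero.mpr hn
  induction A using Multiset.induction_on with
  | empty => simp
  | cons a A ih =>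
    have h1 : ∏ j ∈ range (n + 1), (a + (j : ℂ)) ≠ 0 :=
      prod_ne_zero_iff.mpr fun j _ => hA a (Multiset.mem_cons_self a A) j
    have h2 : Complex.GammaSeq a n * ∏ j ∈ range (n + 1), (a + (j : ℂ))
        = (n : ℂ) ^ a * n.factorial := by
      rw [Complex.GammaSeq, div_mul_cancel₀ _ h1]
    simp only [Multiset.map_cons, Multiset.prod_cons, prod_mul_distrib, Multiset.sum_cons,
      Multiset.card_cons]
    rw [Complex.cpow_add _ _ hn', pow_succ]
    linear_combination (Multiset.map (fun a => Complex.GammaSeq a n) A).prod *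
      (∏ j ∈ range (n + 1), (A.map fun a => a + (j : ℂ)).prod) * h2 +
      (n : ℂ) ^ a * n.factorial * ih fun b hb => hA b (Multiset.mem_cons_of_mem hb)

theorem tendsto_one_of_tendsto_natCast_mul_sub_one {x : ℕ → ℂ} {a : ℂ}
    (h : Tendsto (fun n : ℕ => (n : ℂ) * (x n - 1)) atTop (𝓝 a)) : Tendsto x atTop (𝓝 1) := by
  have h1 := (h.mul (tendsto_inv_atTop_nhds_zero_nat (𝕜 := ℂ))).add_const 1
  rw [mul_zero, zero_add] at h1
  refine h1.congr' ?_
  filter_upwards [eventually_ne_atTop 0] with n hn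
  have : (n : ℂ) ≠ 0 := Nat.cast_ne_zero.mpr hn
  field_simp; ring

/-- From `xy - 1 = (x - 1) y + (y - 1)` and `y → 1`: first-order coefficients in `1/n` add under
multiplication. -/
theorem tendsto_natCast_mul_mul_sub_one {x y : ℕ → ℂ} {a b : ℂ}
    (hx : Tendsto (fun n : ℕ => (n : ℂ) * (x n - 1)) atTop (𝓝 a))
    (hy : Tendsto (fun n : ℕ => (n : ℂ) * (y n - 1)) atTop (𝓝 b)) :
    Tendsto (fun n : ℕ => (n : ℂ) * (x n * y n - 1)) atTop (𝓝 (a + b)) := by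
  have h1 := (hx.mul (tendsto_one_of_tendsto_natCast_mul_sub_one hy)).add hy
  rw [mul_one] at h1
  exact h1.congr fun n => by ring

theorem tendsto_natCast_mul_prod_sub_one (A : Multiset ℂ) :
    Tendsto (fun n : ℕ => (n : ℂ) * ((A.map fun a => 1 + a / (n : ℂ)).prod - 1)) atTop (𝓝 A.sum) := by
  induction A using Multiset.induction_on with
  | empty => simp
  | cons a A ih =>
    simp only [Multiset.map_cons, Multiset.prod_cons, Multiset.sum_cons]
    refine tendsto_natCast_mul_mul_sub_one (tendsto_const_nhds.congr' ?_) ih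
    filter_upwards [eventually_ne_atTop 0] with n hn
    have : (n : ℂ) ≠ 0 := Nat.cast_ne_zero.mpr hn
    field_simp; ring

theorem prod_map_add_natCast (A : Multiset ℂ) {n : ℕ} (hn : n ≠ 0) :
    (A.map fun a => a + (n : ℂ)).prod = (n : ℂ) ^ A.card * (A.map fun a => 1 + a / (n : ℂ)).prod := by
  have : (n : ℂ) ≠ 0 := Nat.cast_ne_zero.mpr hn
  induction A using Multiset.induction_on with
  | empty => simp
  | cons a A ih =>
    simp only [Multiset.map_cons, Multiset.prod_cons, Multiset.card_cons, ih]
    field_simp; ring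

theorem prod_map_Gamma_ne_zero {A : Multiset ℂ} (hA : ∀ a ∈ A, ∀ j : ℕ, a + j ≠ 0) :
    (A.map Complex.Gamma).prod ≠ 0 := by
  refine Multiset.prod_ne_zero fun h => ?_
  obtain ⟨a, ha, h0⟩ := Multiset.mem_map.mp h
  obtain ⟨j, hj⟩ := Complex.Gamma_eq_zero_iff a |>.mp h0
  exact hA a ha j (by rw [hj]; ring)

/-- The growth of a product of values of a rational function, in terms of its zeros and poles. -/
theorem tendsto_prod_div_cpow {g : ℕ → ℂ} {δ : ℂ} {A T : Multiset ℂ} (hcard : A.card = T.card)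
    (hA : ∀ a ∈ A, ∀ j : ℕ, a + j ≠ 0) (hT : ∀ t ∈ T, ∀ j : ℕ, t + j ≠ 0)
    (hg : ∀ n : ℕ, g n * (T.map fun t => t + (n : ℂ)).prod = (A.map fun a => a + (n : ℂ)).prod)
    (hδ : Tendsto (fun n : ℕ => (n : ℂ) * (g n - 1)) atTop (𝓝 δ)) :
    Tendsto (fun n : ℕ => (∏ j ∈ range n, g j) / (n : ℂ) ^ δ) atTop
      (𝓝 ((T.map Complex.Gamma).prod / (A.map Complex.Gamma).prod)) := by
  -- Comparison of the coefficients of `1/n` on both sides of `hg`; it fixes the power of `n` left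
  -- over from Euler's formula.
  have hsum : A.sum = δ + T.sum := by
    refine tendsto_nhds_unique (tendsto_natCast_mul_prod_sub_one A)
      ((tendsto_natCast_mul_mul_sub_one hδ (tendsto_natCast_mul_prod_sub_one T)).congr' ?_)
    filter_upwards [eventually_ne_atTop 0] with n hn
    have h0 : (n : ℂ) ^ A.card ≠ 0 := pow_ne_zero _ (Nat.cast_ne_zero.mpr hn)
    have h1 := hg n
    rw [prod_map_add_natCast A hn, prod_map_add_natCast T hn, ← hcard, mul_left_comm] at h1
    rw [mul_left_cancel₀ h0 h1]
  have hΓ : ∀ S : Multiset ℂ, Tendsto (fun n : ℕ => (S.map fun a => Complex.GammaSeq a n).prod)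
      atTop (𝓝 (S.map Complex.Gamma).prod) := fun S =>
    tendsto_multiset_prod S fun a _ => Complex.GammaSeq_tendsto_Gamma a
  have hA0 := prod_map_Gamma_ne_zero hA
  have hg1 := tendsto_one_of_tendsto_natCast_mul_sub_one hδ
  -- Euler's sequence has `n + 1` factors and the product only `n`; the surplus factor `g n` tends
  -- to `1`.
  have hlim := (((hΓ T).div (hΓ A) hA0).div hg1 one_ne_zero)
  rw [div_one] at hlim
  refine hlim.congr' ?_
  filter_upwards [eventually_ne_atTop 0, (hΓ A).eventually_ne hA0, hg1.eventually_ne one_ne_zero]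
    with n hn hAn hgn
  have hn' : (n : ℂ) ≠ 0 := Nat.cast_ne_zero.mpr hn
  have h1 := prod_GammaSeq_mul_prod A hA hn
  have h2 := prod_GammaSeq_mul_prod T hT hn
  have h3 : (∏ j ∈ range (n + 1), g j) * ∏ j ∈ range (n + 1), (T.map fun t => t + (j : ℂ)).prod
      = ∏ j ∈ range (n + 1), (A.map fun a => a + (j : ℂ)).prod := by
    rw [← prod_mul_distrib]; exact prod_congr rfl fun j _ => hg j
  rw [hsum, Complex.cpow_add _ _ hn', hcard] at h1
  rw [← h3] at h1
  have h4 : (n : ℂ) ^ T.sum * (n.factorial : ℂ) ^ T.card ≠ 0 :=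
    mul_ne_zero (by rw [Complex.cpow_ne_zero_iff]; exact Or.inl hn')
      (pow_ne_zero _ (Nat.cast_ne_zero.mpr n.factorial_ne_zero))
  have h5 : (n : ℂ) ^ δ ≠ 0 := by rw [Complex.cpow_ne_zero_iff]; exact Or.inl hn'
  rw [prod_range_succ] at h1
  simp only [Pi.div_apply]
  rw [div_div, div_eq_div_iff (mul_ne_zero hAn hgn) h5]
  refine mul_right_cancel₀ h4 ?_
  linear_combination (-(T.map fun a => Complex.GammaSeq a n).prod) * h1 +
    (∏ j ∈ range n, g j) * g n * (A.map fun a => Complex.GammaSeq a n).prod * h2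

/-! ### The polynomials `P_s` and `Q_s` -/

namespace UrnScheme

variable (U : UrnScheme) (model : SamplingModel)


theorem natDegree_linearTerm (t : ℂ) :
    (Polynomial.C (U.σ : ℂ) * Polynomial.X + Polynomial.C t).natDegree = 1 :=
  Polynomial.natDegree_linear (Nat.cast_ne_zero.mpr (Nat.one_le_iff_ne_zero.mp U.one_le_σ))

theorem leadingCoeff_linearTerm (t : ℂ) :
    (Polynomial.C (U.σ : ℂ) * Polynomial.X + Polynomial.C t).leadingCoeff = (U.σ : ℂ) :=
  Polynomial.leadingCoeff_linear (Nat.cast_ne_zero.mpr (Nat.one_le_iff_ne_zero.mp U.one_le_σ))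

theorem natDegree_binomPoly_le (l d : ℕ) : (U.binomPoly l d).natDegree ≤ d := by
  refine (Polynomial.natDegree_C_mul_le _ _).trans ?_
  rw [Polynomial.natDegree_comp, natDegree_linearTerm, descPochhammer_natDegree, mul_one]

theorem coeff_binomPoly (l d : ℕ) :
    (U.binomPoly l d).coeff d = (U.σ : ℂ) ^ d / (d.factorial : ℂ) := by
  have h1 : ((descPochhammer ℂ d).comp (Polynomial.C (U.σ : ℂ) * Polynomial.X +
      Polynomial.C ((U.T 0 : ℂ) - (l : ℂ)))).coeff d = (U.σ : ℂ) ^ d := by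
    have h2 := Polynomial.leadingCoeff_comp (p := descPochhammer ℂ d)
      (q := Polynomial.C (U.σ : ℂ) * Polynomial.X + Polynomial.C ((U.T 0 : ℂ) - (l : ℂ)))
      (by rw [natDegree_linearTerm]; exact one_ne_zero)
    rw [leadingCoeff_linearTerm, (monic_descPochhammer ℂ d).leadingCoeff, one_mul,
      descPochhammer_natDegree, Polynomial.leadingCoeff, Polynomial.natDegree_comp,
      natDegree_linearTerm, descPochhammer_natDegree, mul_one] at h2
    exact h2
  rw [binomPoly, Polynomial.coeff_C_mul, h1]; ring

theorem eval_binomPoly {n l : ℕ} (h : l ≤ U.T n) (d : ℕ) :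
    (U.binomPoly l d).eval (n : ℂ) = ((U.T n - l).choose d : ℂ) := by
  have h1 : (U.σ : ℂ) * n + ((U.T 0 : ℂ) - l) = ((U.T n - l : ℕ) : ℂ) := by
    rw [Nat.cast_sub h]; unfold T; push_cast; ring
  have h2 : (d.factorial : ℂ) ≠ 0 := Nat.cast_ne_zero.mpr d.factorial_ne_zero
  rw [binomPoly]
  simp only [Polynomial.eval_mul, Polynomial.eval_C, Polynomial.eval_comp, Polynomial.eval_add,
    Polynomial.eval_X]
  rw [h1, descPochhammer_eval_eq_descFactorial, Nat.descFactorial_eq_factorial_mul_choose]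
  push_cast; field_simp

theorem natDegree_polyP_le (s : ℕ) : (U.polyP s).natDegree ≤ min s U.m := by
  refine (Polynomial.natDegree_C_mul_le _ _).trans (Polynomial.natDegree_sum_le_of_forall_le _ _ ?_)
  intro l _
  exact (Polynomial.natDegree_C_mul_le _ _).trans
    ((U.natDegree_binomPoly_le _ _).trans (Nat.sub_le _ _))

/-- Only `l = 0` reaches the top degree, and the prefactor is the inverse of its leading
coefficient. -/
theorem coeff_polyP (s : ℕ) : (U.polyP s).coeff (min s U.m) = 1 := by
  have hσ : (U.σ : ℂ) ≠ 0 := Nat.cast_ne_zero.mpr (Nat.one_le_iff_ne_zero.mp U.one_le_σ)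
  have h2 : ((min s U.m).factorial : ℂ) ≠ 0 := Nat.cast_ne_zero.mpr (Nat.factorial_ne_zero _)
  rw [polyP, Polynomial.coeff_C_mul, Polynomial.finsetSum_coeff, sum_eq_single 0]
  · rw [Polynomial.coeff_C_mul, Nat.sub_zero, coeff_binomPoly]
    simp only [Nat.choose_zero_right, pow_zero, Nat.cast_one]
    field_simp
  · intro l hl hl0
    rw [Polynomial.coeff_C_mul, Polynomial.coeff_eq_zero_of_natDegree_lt, mul_zero]
    refine (U.natDegree_binomPoly_le _ _).trans_lt ?_
    rw [mem_range] at hl; omega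
  · intro h; exact absurd (mem_range.mpr (Nat.succ_pos _)) h

theorem natDegree_polyQ_le (s : ℕ) : (U.polyQ s).natDegree ≤ s := by
  refine (Polynomial.natDegree_C_mul_le _ _).trans (Polynomial.natDegree_sum_le_of_forall_le _ _ ?_)
  intro l _
  refine (Polynomial.natDegree_C_mul_le _ _).trans ?_
  rw [Polynomial.natDegree_pow, natDegree_linearTerm, mul_one]
  exact Nat.sub_le _ _

theorem coeff_polyQ (s : ℕ) : (U.polyQ s).coeff s = 1 := by
  have hσ : (U.σ : ℂ) ≠ 0 := Nat.cast_ne_zero.mpr (Nat.one_le_iff_ne_zero.mp U.one_le_σ)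
  rw [polyQ, Polynomial.coeff_C_mul, Polynomial.finsetSum_coeff, sum_eq_single 0]
  · have h1 := Polynomial.leadingCoeff_pow
      (p := Polynomial.C (U.σ : ℂ) * Polynomial.X + Polynomial.C (U.T 0 : ℂ)) (n := s)
    rw [leadingCoeff_linearTerm, Polynomial.leadingCoeff, Polynomial.natDegree_pow,
      natDegree_linearTerm, mul_one] at h1
    rw [Polynomial.coeff_C_mul, Nat.sub_zero, h1]
    simp only [Nat.choose_zero_right, pow_zero, Nat.cast_one, Nat.factorial_zero]
    field_simp
  · intro l hl hl0
    rw [Polynomial.coeff_C_mul, Polynomial.coeff_eq_zero_of_natDegree_lt, mul_zero]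
    rw [Polynomial.natDegree_pow, natDegree_linearTerm]
    rw [mem_range] at hl; omega
  · intro h; exact absurd (mem_range.mpr (Nat.succ_pos _)) h

/-- The values of `P_s` at natural numbers. -/
theorem eval_polyP (n s : ℕ) :
    (U.polyP s).eval (n : ℂ) = (U.f .M (n + 1) s s : ℂ) *
      ∏ l ∈ Icc 1 (min s U.m), (((U.T 0 : ℂ) + 1 - (l : ℂ)) / (U.σ : ℂ) + n) := by
  have hσ : (U.σ : ℂ) ≠ 0 := Nat.cast_ne_zero.mpr (Nat.one_le_iff_ne_zero.mp U.one_le_σ)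
  obtain ⟨d, hd⟩ : ∃ d, d = min s U.m := ⟨_, rfl⟩
  have hdm : d ≤ U.m := hd ▸ min_le_right _ _
  have hdT : d ≤ U.T n := hdm.trans (U.m_le_T n)
  have h1 : ∏ l ∈ Icc 1 d, (((U.T 0 : ℂ) + 1 - (l : ℂ)) / (U.σ : ℂ) + n)
      = (d.factorial : ℂ) * ((U.T n).choose d : ℂ) / (U.σ : ℂ) ^ d := by
    rw [← Nat.cast_mul, ← Nat.descFactorial_eq_factorial_mul_choose,
      ← descPochhammer_eval_eq_descFactorial, descPochhammer_eval_eq_prod_range]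
    have h2 : ∏ l ∈ Icc 1 d, (((U.T 0 : ℂ) + 1 - (l : ℂ)) / (U.σ : ℂ) + n)
        = ∏ x ∈ range d, (((U.T n : ℂ) - x) / U.σ) := by
      rw [range_eq_Ico]
      refine (prod_Ico_add' (fun l : ℕ => ((U.T 0 : ℂ) + 1 - (l : ℂ)) / (U.σ : ℂ) + n)
        0 d 1).symm.trans (prod_congr rfl fun l _ => ?_)
      have h3 : (U.T n : ℂ) = U.T 0 + U.σ * n := by unfold T; push_cast; ring
      rw [h3]; field_simp; push_cast; ring
    rw [h2, prod_div_distrib, prod_const, card_range]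
  -- Orders above `d` but at most `s` exceed `m`, where `sampleCoeff` is an empty sum.
  have h2 : U.f .M (n + 1) s s = ∑ l ∈ range (d + 1), (s.choose l : ℝ) * U.jumpConst ^ l *
      ((U.m.choose l : ℝ) / ((U.T n).choose l : ℝ)) := by
    rw [f_diag_succ]
    symm
    rw [← sum_subset (range_subset_range.mpr (show d + 1 ≤ s + 1 by omega))]
    · refine sum_congr rfl fun l hl => ?_
      rw [mem_range] at hl
      simp only [sampleCoeff]
      rw [show min l U.m = l by omega, Icc_self, sum_singleton]
      simp [Nat.stirlingFirst_self, Nat.stirlingSecond_self]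
    · intro l hl hl'
      simp only [mem_range] at hl hl'
      simp only [sampleCoeff]
      rw [Icc_eq_empty (by rw [le_min_iff]; omega), sum_empty, mul_zero]
  rw [polyP, ← hd, h1, h2, Polynomial.eval_mul, Polynomial.eval_C, Polynomial.eval_finsetSum]
  push_cast
  rw [mul_sum, sum_mul]
  refine sum_congr rfl fun l hl => ?_
  have hl' : l ≤ d := by have := mem_range.mp hl; omega
  rw [Polynomial.eval_mul, Polynomial.eval_C, U.eval_binomPoly (hl'.trans hdT)]
  have h3 : ((U.T n).choose d : ℂ) * d.choose l = (U.T n).choose l * (U.T n - l).choose (d - l) := by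
    exact_mod_cast Nat.choose_mul hl'
  have h4 : (d.choose l : ℂ) ≠ 0 := Nat.cast_ne_zero.mpr (Nat.choose_pos hl').ne'
  have h5 : ((U.T n).choose l : ℂ) ≠ 0 :=
    Nat.cast_ne_zero.mpr (Nat.choose_pos (hl'.trans hdT)).ne'
  field_simp
  linear_combination (-(d.factorial : ℂ) * s.choose l * (U.jumpConst : ℂ) ^ l * U.m.choose l) * h3

/-- The values of `Q_s` at natural numbers. -/
theorem eval_polyQ (n s : ℕ) :
    (U.polyQ s).eval (n : ℂ) = (U.f .R (n + 1) s s : ℂ) * ((U.T 0 : ℂ) / U.σ + n) ^ s := by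
  have hσ : (U.σ : ℂ) ≠ 0 := Nat.cast_ne_zero.mpr (Nat.one_le_iff_ne_zero.mp U.one_le_σ)
  have hT : (U.T n : ℂ) ≠ 0 := Nat.cast_ne_zero.mpr (U.T_pos n).ne'
  have h1 : (U.T 0 : ℂ) / U.σ + n = U.T n / U.σ := by
    unfold T; push_cast; field_simp; ring
  have h2 : (U.σ : ℂ) * n + U.T 0 = U.T n := by unfold T; push_cast; ring
  rw [polyQ, h1, f_diag_succ, Polynomial.eval_mul, Polynomial.eval_C, Polynomial.eval_finsetSum]
  push_cast
  rw [mul_sum, sum_mul]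
  refine sum_congr rfl fun l hl => ?_
  have hl' : l ≤ s := by have := mem_range.mp hl; omega
  simp only [Polynomial.eval_mul, Polynomial.eval_C, Polynomial.eval_pow, Polynomial.eval_add,
    Polynomial.eval_X, h2, sampleCoeff, Nat.stirlingSecond_self, Nat.add_sub_cancel,
    Nat.descFactorial_eq_factorial_mul_choose]
  push_cast
  rw [div_pow, pow_sub₀ _ hT hl']
  field_simp

end UrnScheme

/-! ### Asymptotics of the coefficients and of the diagonal products -/

namespace UrnScheme

variable (U : UrnScheme) (model : SamplingModel)

open Asymptotics

theorem natCast_le_T (n : ℕ) : (n : ℝ) ≤ U.T n := by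
  have h1 := U.one_le_σ
  have h2 : n ≤ U.T n := by unfold T; nlinarith
  exact_mod_cast h2

/-- Since `h ≤ m ≤ T_0`, all `h` factors of the falling factorial of `T_n` are at least `n`. -/
theorem pow_le_factorial_mul_choose_T {h : ℕ} (hh : h ≤ U.m) (n : ℕ) :
    (n : ℝ) ^ h ≤ h.factorial * ((U.T n).choose h : ℝ) := by
  have h0 : (((U.T n + 1 - h : ℕ) : ℝ) ^ h / (h.factorial : ℝ) ≤ (U.T n).choose h) :=
    Nat.pow_le_choose h (U.T n)
  rw [div_le_iff₀' (Nat.cast_pos.mpr h.factorial_pos)] at h0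
  refine le_trans ?_ h0
  refine pow_le_pow_left₀ (Nat.cast_nonneg _) (Nat.cast_le.mpr ?_) _
  have h1 := U.one_le_σ
  have h2 := U.m_le_total
  have h3 : U.W₀ + U.B₀ + n ≤ U.T n := by unfold T; nlinarith
  omega

/-- In model `M` only orders `h ≥ l` occur, and `binom(T_n, h)` grows at least like `n^h`; in model
`R` the denominator is `T_n^l`. -/
theorem sampleCoeff_isBigO (i l : ℕ) :
    (fun n : ℕ => U.sampleCoeff model (n + 1) i l) =O[atTop] fun n : ℕ => ((n : ℝ) ^ l)⁻¹ := by
  cases model with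
  | M =>
    simp only [sampleCoeff, Nat.add_sub_cancel]
    refine IsBigO.fun_sum fun h hh => ?_
    simp only [mem_Icc, le_min_iff] at hh
    simp only [div_eq_mul_inv]
    refine IsBigO.const_mul_left ?_ _
    refine IsBigO.of_bound h.factorial ?_
    filter_upwards [eventually_ge_atTop 1] with n hn
    have hn' : (1 : ℝ) ≤ n := by exact_mod_cast hn
    have h1 := U.pow_le_factorial_mul_choose_T hh.2.2 n
    have h2 : (n : ℝ) ^ l ≤ (n : ℝ) ^ h := pow_le_pow_right₀ hn' hh.1
    have h3 : (0 : ℝ) < (U.T n).choose h :=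
      Nat.cast_pos.mpr (Nat.choose_pos (hh.2.2.trans (U.m_le_T n)))
    have h4 : (0 : ℝ) < (n : ℝ) ^ l := by positivity
    rw [norm_inv, norm_inv, Real.norm_of_nonneg h3.le, Real.norm_of_nonneg h4.le,
      ← div_eq_mul_inv, inv_eq_one_div, div_le_div_iff₀ h3 h4, one_mul]
    exact h2.trans h1
  | R =>
    simp only [sampleCoeff, Nat.add_sub_cancel, div_eq_mul_inv]
    refine IsBigO.const_mul_left (IsBigO.of_bound 1 ?_) _
    filter_upwards [eventually_ge_atTop 1] with n hn
    have hn' : (0 : ℝ) < n := by exact_mod_cast hn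
    rw [one_mul, norm_inv, norm_inv, norm_pow, norm_pow, Real.norm_natCast, Real.norm_natCast]
    exact inv_anti₀ (by positivity) (pow_le_pow_left₀ hn'.le (U.natCast_le_T n) l)

theorem sampleCoeff_one_zero (n : ℕ) : U.sampleCoeff model n 1 0 = 0 := by
  cases model with
  | M =>
    simp only [sampleCoeff]
    refine sum_eq_zero fun h hh => ?_
    rcases h with _ | h <;> simp
  | R => simp [sampleCoeff]

theorem sampleCoeff_one_one (n : ℕ) : U.sampleCoeff model (n + 1) 1 1 = U.m / U.T n := by
  cases model with
  | M =>
    simp only [sampleCoeff]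
    rw [min_eq_left U.one_le_m, Icc_self, sum_singleton]
    simp [Nat.stirlingFirst_self, Nat.stirlingSecond_self]
  | R => simp [sampleCoeff, Nat.stirlingSecond_self]

theorem tendsto_natCast_div_T : Tendsto (fun n : ℕ => (n : ℝ) / U.T n) atTop (𝓝 (1 / U.σ)) := by
  have hσ : (U.σ : ℝ) ≠ 0 := Nat.cast_ne_zero.mpr (Nat.one_le_iff_ne_zero.mp U.one_le_σ)
  have h1 : Tendsto (fun n : ℕ => 1 / ((U.T 0 : ℝ) / n + U.σ)) atTop (𝓝 (1 / (0 + U.σ))) :=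
    tendsto_const_nhds.div ((tendsto_const_div_atTop_nhds_zero_nat _).add_const _)
      (by rwa [zero_add])
  rw [zero_add] at h1
  refine h1.congr' ?_
  filter_upwards [eventually_ne_atTop 0] with n hn
  have hn' : (n : ℝ) ≠ 0 := Nat.cast_ne_zero.mpr hn
  have h2 : (U.T n : ℝ) = U.T 0 + U.σ * n := by unfold T; push_cast; ring
  rw [h2]; field_simp

theorem tendsto_natCast_mul_sampleCoeff_diag {j : ℕ} (hj : 2 ≤ j) :
    Tendsto (fun n : ℕ => (n : ℝ) * U.sampleCoeff model (n + 1) j j) atTop (𝓝 0) := by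
  have h1 := (isBigO_refl (fun n : ℕ => (n : ℝ)) atTop).mul (U.sampleCoeff_isBigO model j j)
  refine (h1.trans (IsBigO.of_bound 1 ?_)).trans_tendsto
    (tendsto_inv_atTop_nhds_zero_nat (𝕜 := ℝ))
  filter_upwards [eventually_ge_atTop 1] with n hn
  have hn' : (1 : ℝ) ≤ n := by exact_mod_cast hn
  have h0 : (0 : ℝ) < n := by linarith
  rw [one_mul, Real.norm_of_nonneg (by positivity), Real.norm_of_nonneg (by positivity),
    ← div_eq_mul_inv, inv_eq_one_div, div_le_div_iff₀ (by positivity) h0, one_mul, ← pow_two]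
  exact pow_le_pow_right₀ hn' hj

/-- Only `j = 1` is of order `1/n`: it equals `s C m / T_n`, and `C m / σ = Λ`. -/
theorem tendsto_natCast_mul_f_diag_sub_one (s : ℕ) :
    Tendsto (fun n : ℕ => (n : ℝ) * (U.f model (n + 1) s s - 1)) atTop (𝓝 (s * U.Λ)) := by
  have hm : (U.m : ℝ) ≠ 0 := Nat.cast_ne_zero.mpr (Nat.one_le_iff_ne_zero.mp U.one_le_m)
  have hσ : (U.σ : ℝ) ≠ 0 := Nat.cast_ne_zero.mpr (Nat.one_le_iff_ne_zero.mp U.one_le_σ)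
  have h1 : ∀ n : ℕ, (n : ℝ) * (U.f model (n + 1) s s - 1)
      = ∑ j ∈ range s, (s.choose (j + 1) : ℝ) * U.jumpConst ^ (j + 1) *
        ((n : ℝ) * U.sampleCoeff model (n + 1) (j + 1) (j + 1)) := by
    intro n
    rw [f_diag_succ, sum_range_succ', sampleCoeff_zero_zero]
    simp only [Nat.choose_zero_right, Nat.cast_one, pow_zero, mul_one, add_sub_cancel_right]
    rw [mul_sum]
    exact sum_congr rfl fun j _ => by ring
  simp only [h1]
  have h2 : ∀ j ∈ range s, Tendsto (fun n : ℕ => (s.choose (j + 1) : ℝ) * U.jumpConst ^ (j + 1) *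
        ((n : ℝ) * U.sampleCoeff model (n + 1) (j + 1) (j + 1))) atTop
        (𝓝 (if j = 0 then s * U.Λ else 0)) := by
    intro j _
    rcases j with _ | j
    · rw [if_pos rfl]
      have h3 := (U.tendsto_natCast_div_T).const_mul ((s : ℝ) * U.jumpConst * U.m)
      have h4 : (s : ℝ) * U.jumpConst * U.m * (1 / U.σ) = s * U.Λ := by
        rw [jumpConst]; field_simp
      rw [h4] at h3
      refine h3.congr fun n => ?_
      rw [zero_add, Nat.choose_one_right, pow_one, sampleCoeff_one_one]; ring
    · rw [if_neg (Nat.succ_ne_zero j)]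
      have h3 := (U.tendsto_natCast_mul_sampleCoeff_diag model (by omega : 2 ≤ j + 1 + 1)).const_mul
        ((s.choose (j + 1 + 1) : ℝ) * U.jumpConst ^ (j + 1 + 1))
      rwa [mul_zero] at h3
  have h3 := tendsto_finsetSum (range s) h2
  rw [sum_ite_eq'] at h3
  rcases Nat.eq_zero_or_pos s with rfl | hs
  · simp
  · rwa [if_pos (mem_range.mpr hs)] at h3

/-- Common to both models. Since `P` is monic and splits over `ℂ`, the diagonal coefficient is a
quotient of products of linear factors in `n`. No root of `P` is a natural number because `f ≥ 1`
there, so the values `Γ(-z)` avoid the poles. -/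
theorem tendsto_prod_f_div_cpow {s d : ℕ} {P : Polynomial ℂ} {T : Multiset ℂ}
    (hL : U.IsLargeIndex) (hdeg : P.natDegree ≤ d) (hcoeff : P.coeff d = 1) (hcard : T.card = d)
    (hT : ∀ t ∈ T, 0 < t.re)
    (hP : ∀ n : ℕ, P.eval (n : ℂ) = (U.f model (n + 1) s s : ℂ) * (T.map fun t => t + (n : ℂ)).prod) :
    Tendsto (fun n : ℕ => (U.diagProd model n s : ℂ) / (n : ℂ) ^ (s * U.Λ : ℂ)) atTop
      (𝓝 ((T.map Complex.Gamma).prod / (P.roots.map fun z => Complex.Gamma (-z)).prod)) ∧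
    (T.map Complex.Gamma).prod / (P.roots.map fun z => Complex.Gamma (-z)).prod ≠ 0 := by
  have hmonic := Polynomial.monic_of_natDegree_le_of_coeff_eq_one d hdeg hcoeff
  have hsplit := IsAlgClosed.splits P
  have hdeg' : P.natDegree = d :=
    Polynomial.natDegree_eq_of_le_of_coeff_ne_zero hdeg (by rw [hcoeff]; exact one_ne_zero)
  have hTj : ∀ t ∈ T, ∀ j : ℕ, t + j ≠ 0 := by
    intro t ht j h0
    have h1 := congrArg Complex.re h0
    have h2 := hT t ht
    have h3 : (0 : ℝ) ≤ j := Nat.cast_nonneg j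
    simp at h1; linarith
  have heval : ∀ n : ℕ, P.eval (n : ℂ) ≠ 0 := by
    intro n
    rw [hP]
    have h1 : U.f model (n + 1) s s ≠ 0 :=
      (zero_lt_one.trans_le (hL.one_le_f_diag model (n + 1) s)).ne'
    refine mul_ne_zero (Complex.ofReal_ne_zero.mpr h1) (Multiset.prod_ne_zero fun h => ?_)
    obtain ⟨t, ht, h0⟩ := Multiset.mem_map.mp h
    exact hTj t ht n h0
  have hprod : ∀ n : ℕ, P.eval (n : ℂ) = ((P.roots.map fun z => -z).map fun a => a + (n : ℂ)).prod := by
    intro n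
    rw [hsplit.eval_eq_prod_roots_of_monic hmonic, Multiset.map_map]
    congr 1
    exact Multiset.map_congr rfl fun z _ => by simp only [Function.comp]; ring
  have hAj : ∀ a ∈ P.roots.map fun z => -z, ∀ j : ℕ, a + j ≠ 0 := by
    intro a ha j h0
    obtain ⟨z, hz, rfl⟩ := Multiset.mem_map.mp ha
    have h1 : (j : ℂ) = z := by linear_combination h0
    exact heval j (by rw [h1]; exact (Polynomial.mem_roots'.mp hz).2)
  have hne := div_ne_zero (prod_map_Gamma_ne_zero hTj) (prod_map_Gamma_ne_zero hAj)
  have h := tendsto_prod_div_cpow (g := fun n => (U.f model (n + 1) s s : ℂ))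
    (δ := (s * U.Λ : ℂ)) (A := P.roots.map fun z => -z) (T := T)
    (by rw [Multiset.card_map, hcard, ← hdeg', hsplit.natDegree_eq_card_roots])
    hAj hTj (fun n => by rw [← hP, hprod])
    (by
      have := (Complex.continuous_ofReal.tendsto _).comp
        (U.tendsto_natCast_mul_f_diag_sub_one model s)
      simpa [Function.comp_def] using this)
  rw [Multiset.map_map] at h hne
  refine ⟨h.congr fun n => ?_, hne⟩
  congr 1
  rw [diagProd]
  push_cast
  rw [range_eq_Ico]
  exact prod_Ico_add' (fun j => (U.f model j s s : ℂ)) 0 n 1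

variable {U} in
/-- The growth of the diagonal products. -/
theorem IsLargeIndex.tendsto_diagProd_div_cpow (hL : U.IsLargeIndex) (s : ℕ) :
    Tendsto (fun n : ℕ => (U.diagProd model n s : ℂ) / (n : ℂ) ^ (s * U.Λ : ℂ)) atTop
      (𝓝 (U.gammaFactor model s)) ∧ U.gammaFactor model s ≠ 0 := by
  have hσ : (0 : ℝ) < U.σ := by exact_mod_cast U.one_le_σ
  cases model with
  | M =>
    have h := U.tendsto_prod_f_div_cpow .M (s := s) (d := min s U.m) (P := U.polyP s)
      (T := (Icc 1 (min s U.m)).val.map fun l : ℕ => ((U.T 0 : ℂ) + 1 - (l : ℂ)) / (U.σ : ℂ)) hL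
      (U.natDegree_polyP_le s) (U.coeff_polyP s) (by simp)
      (by
        intro t ht
        obtain ⟨l, hl, rfl⟩ := Multiset.mem_map.mp ht
        rw [mem_val, mem_Icc, le_min_iff] at hl
        have h1 : (l : ℝ) ≤ U.T 0 := by exact_mod_cast hl.2.2.trans (U.m_le_T 0)
        have h2 : ((U.T 0 : ℂ) + 1 - (l : ℂ)) / (U.σ : ℂ)
          = (((U.T 0 + 1 - l) / U.σ : ℝ) : ℂ) := by push_cast; ring
        rw [h2, Complex.ofReal_re]
        exact div_pos (by linarith) hσ)
      (by intro n; rw [U.eval_polyP, Multiset.map_map]; rfl)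
    rw [Multiset.map_map] at h
    exact h
  | R =>
    have h := U.tendsto_prod_f_div_cpow .R (s := s) (d := s) (P := U.polyQ s)
      (T := Multiset.replicate s ((U.T 0 : ℂ) / U.σ)) hL
      (U.natDegree_polyQ_le s) (U.coeff_polyQ s) (by simp)
      (by
        intro t ht
        rw [Multiset.eq_of_mem_replicate ht]
        have h1 : (0 : ℝ) < U.T 0 := by exact_mod_cast U.T_pos 0
        have h2 : (U.T 0 : ℂ) / (U.σ : ℂ) = ((U.T 0 / U.σ : ℝ) : ℂ) := by push_cast; ring
        rw [h2, Complex.ofReal_re]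
        exact div_pos h1 hσ)
      (by intro n; rw [U.eval_polyQ]; simp)
    rw [Multiset.map_replicate, Multiset.prod_replicate] at h
    exact h

theorem ofReal_diagProd_div_rpow (n s : ℕ) :
    ((U.diagProd model n s / (n : ℝ) ^ (s * U.Λ) : ℝ) : ℂ)
      = (U.diagProd model n s : ℂ) / (n : ℂ) ^ (s * U.Λ : ℂ) := by
  rw [Complex.ofReal_div, Complex.ofReal_cpow (Nat.cast_nonneg n)]
  push_cast; rfl

variable {U} in
-- The Gamma factor is a limit of real numbers, hence real, although the roots may be complex.
theorem IsLargeIndex.exists_tendsto_diagProd_div_rpow (hL : U.IsLargeIndex) (s : ℕ) :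
    ∃ c : ℝ, (c : ℂ) = U.gammaFactor model s ∧ c ≠ 0 ∧
      Tendsto (fun n : ℕ => U.diagProd model n s / (n : ℝ) ^ (s * U.Λ)) atTop (𝓝 c) := by
  obtain ⟨h, h0⟩ := hL.tendsto_diagProd_div_cpow model s
  simp only [← ofReal_diagProd_div_rpow] at h
  have hre := (Complex.continuous_re.tendsto _).comp h
  simp only [Function.comp_def, Complex.ofReal_re] at hre
  have hc := tendsto_nhds_unique ((Complex.continuous_ofReal.tendsto _).comp hre) h
  exact ⟨(U.gammaFactor model s).re, hc, fun h1 => h0 (by rw [← hc, h1, Complex.ofReal_zero]), hre⟩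

/-- The power of the shift contributes `n^(l - (j - (s - r)))` and the sample coefficients `n^(-l)`;
`l` cancels. -/
theorem f_isBigO_inv_pow (s r j l : ℕ) (hl : j - (s - r) ≤ l) :
    (fun n : ℕ => (l.choose (j - (s - r)) : ℝ) *
        ((U.a U.m : ℝ) * n / (1 - U.Λ)) ^ (l - (j - (s - r))) *
        ∑ i ∈ range (j + 1), (j.choose i : ℝ) *
          ((U.σ : ℝ) ^ i * (U.a U.m : ℝ) ^ (j - i) / ((U.m : ℝ) ^ i * (U.Λ - 1) ^ (j - i))) *
          U.sampleCoeff model (n + 1) i l) =O[atTop] fun n : ℕ => ((n : ℝ) ^ (j - (s - r)))⁻¹ := by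
  have h1 : (fun n : ℕ => ((U.a U.m : ℝ) * n / (1 - U.Λ)) ^ (l - (j - (s - r)))) =O[atTop]
      fun n : ℕ => (n : ℝ) ^ (l - (j - (s - r))) := by
    refine IsBigO.pow ?_ _
    have : (fun n : ℕ => (U.a U.m : ℝ) * n / (1 - U.Λ))
        = fun n : ℕ => (U.a U.m : ℝ) / (1 - U.Λ) * n := by ext; ring
    rw [this]
    exact (isBigO_refl _ _).const_mul_left _
  have h2 : (fun n : ℕ => ∑ i ∈ range (j + 1), (j.choose i : ℝ) *
          ((U.σ : ℝ) ^ i * (U.a U.m : ℝ) ^ (j - i) / ((U.m : ℝ) ^ i * (U.Λ - 1) ^ (j - i))) *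
          U.sampleCoeff model (n + 1) i l) =O[atTop] fun n : ℕ => ((n : ℝ) ^ l)⁻¹ :=
    IsBigO.fun_sum fun i _ => (U.sampleCoeff_isBigO model i l).const_mul_left _
  refine (((h1.const_mul_left (l.choose (j - (s - r)) : ℝ)).mul h2)).trans ?_
  refine IsBigO.of_bound 1 ?_
  filter_upwards [eventually_ne_atTop 0] with n hn
  have hn' : (n : ℝ) ≠ 0 := Nat.cast_ne_zero.mpr hn
  rw [one_mul]
  refine le_of_eq (congrArg _ ?_)
  have h3 : (n : ℝ) ^ l = n ^ (l - (j - (s - r))) * n ^ (j - (s - r)) := by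
    rw [← pow_add, Nat.sub_add_cancel hl]
  rw [h3]; field_simp

theorem f_term_isBigO (s r j : ℕ) :
    (fun n : ℕ => (s.choose j : ℝ) * U.Λ ^ j *
      ∑ l ∈ range (j + 1), (l.choose (j - (s - r)) : ℝ) *
        ((U.a U.m : ℝ) * n / (1 - U.Λ)) ^ (l - (j - (s - r))) *
        ∑ i ∈ range (j + 1), (j.choose i : ℝ) *
          ((U.σ : ℝ) ^ i * (U.a U.m : ℝ) ^ (j - i) / ((U.m : ℝ) ^ i * (U.Λ - 1) ^ (j - i))) *
          U.sampleCoeff model (n + 1) i l) =O[atTop]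
      fun n : ℕ => ((n : ℝ) ^ (j - (s - r)))⁻¹ := by
  refine IsBigO.const_mul_left (IsBigO.fun_sum fun l _ => ?_) _
  rcases Nat.lt_or_ge l (j - (s - r)) with hl | hl
  · simp only [Nat.choose_eq_zero_of_lt hl, Nat.cast_zero, zero_mul]
    exact isBigO_zero _ _
  · exact U.f_isBigO_inv_pow model s r j l hl

theorem inv_pow_isBigO_inv_pow {a b : ℕ} (h : a ≤ b) :
    (fun n : ℕ => ((n : ℝ) ^ b)⁻¹) =O[atTop] fun n : ℕ => ((n : ℝ) ^ a)⁻¹ := by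
  refine IsBigO.of_bound 1 ?_
  filter_upwards [eventually_ge_atTop 1] with n hn
  have hn' : (1 : ℝ) ≤ n := by exact_mod_cast hn
  rw [one_mul, Real.norm_of_nonneg (by positivity), Real.norm_of_nonneg (by positivity)]
  exact inv_anti₀ (by positivity) (pow_le_pow_right₀ hn' h)

theorem f_isBigO_one (s r : ℕ) :
    (fun n : ℕ => U.f model (n + 1) s r) =O[atTop] fun _ : ℕ => (1 : ℝ) := by
  simp only [f_succ]
  refine IsBigO.fun_sum fun j _ => (U.f_term_isBigO model s r j).trans ?_
  simpa using inv_pow_isBigO_inv_pow (Nat.zero_le (j - (s - r)))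

/-- The purpose of the shift. Terms with `j ≥ 2` are `O(1/n)` anyway. For `j = 1` the two
contributions `a_m/(Λ-1)` and `σ n a_m/((1-Λ) T_n)` are each of order `1`, but `σn = T_n - T_0`
leaves only a multiple of `1/T_n`. -/
theorem f_isBigO_inv (s : ℕ) :
    (fun n : ℕ => U.f model (n + 1) (s + 1) s) =O[atTop] fun n : ℕ => (n : ℝ)⁻¹ := by
  have hm : (U.m : ℝ) ≠ 0 := Nat.cast_ne_zero.mpr (Nat.one_le_iff_ne_zero.mp U.one_le_m)
  simp only [f_succ]
  refine IsBigO.fun_sum fun j hj => ?_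
  rw [Nat.add_sub_cancel_left, mem_Icc] at hj
  rcases hj.1.eq_or_lt with rfl | hj1
  · simp only [Nat.add_sub_cancel_left, Nat.sub_self, sum_range_succ, range_zero, sum_empty,
      zero_add, sampleCoeff_zero_zero, sampleCoeff_one_zero, sampleCoeff_one_one,
      U.sampleCoeff_eq_zero model Nat.zero_lt_one, Nat.choose_zero_right, Nat.sub_zero, pow_zero,
      pow_one, Nat.choose_self, Nat.cast_one, one_mul, mul_one, mul_zero, add_zero]
    have h1 : ∀ n : ℕ, ((s + 1).choose 1 : ℝ) * U.Λ * ((U.a U.m : ℝ) / (U.Λ - 1) +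
        U.a U.m * n / (1 - U.Λ) * (U.σ / U.m * (U.m / U.T n)))
        = -((s + 1).choose 1 * U.Λ * (U.a U.m / (1 - U.Λ)) * U.T 0) * (U.T n : ℝ)⁻¹ := by
      intro n
      have hT : (U.T n : ℝ) ≠ 0 := Nat.cast_ne_zero.mpr (U.T_pos n).ne'
      have h2 : (U.T n : ℝ) = U.T 0 + U.σ * n := by unfold T; push_cast; ring
      have h3 : (U.a U.m : ℝ) / (U.Λ - 1) = - (U.a U.m / (1 - U.Λ)) := by
        rw [← neg_sub, div_neg]
      have h4 : (U.a U.m : ℝ) * n / (1 - U.Λ) = U.a U.m / (1 - U.Λ) * n := by ring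
      rw [h3, h4]
      generalize (U.a U.m : ℝ) / (1 - U.Λ) = A
      field_simp
      rw [h2]; ring
    simp only [h1]
    refine IsBigO.const_mul_left (IsBigO.of_bound 1 ?_) _
    filter_upwards [eventually_ge_atTop 1] with n hn
    have hn' : (0 : ℝ) < n := by exact_mod_cast hn
    rw [one_mul, norm_inv, norm_inv, Real.norm_natCast, Real.norm_natCast]
    exact inv_anti₀ hn' (U.natCast_le_T n)
  · refine (U.f_term_isBigO model (s + 1) s j).trans ?_
    simpa using inv_pow_isBigO_inv_pow (show 1 ≤ j - (s + 1 - s) by omega)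

end UrnScheme

/-! ### Summability of the jump weights and passage to the limit -/

theorem summable_prod_pi_of_nonneg {v : ℕ → ℝ} (hv : Summable v) (h0 : ∀ n, 0 ≤ v n) (r : ℕ) :
    Summable fun i : Fin r → ℕ => ∏ g, v (i g) := by
  induction r with
  | zero => exact Summable.of_finite
  | succ r ih =>
    rw [← (Fin.consEquiv fun _ : Fin (r + 1) => ℕ).summable_iff]
    refine (hv.mul_of_nonneg ih h0 fun i => prod_nonneg fun g _ => h0 _).congr fun x => ?_
    simp [Function.comp, Fin.prod_univ_succ]

namespace UrnScheme

variable (U : UrnScheme) (model : SamplingModel)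

open Asymptotics

variable {U} in
theorem IsLargeIndex.diagProd_isTheta (hL : U.IsLargeIndex) (s : ℕ) :
    (fun n : ℕ => U.diagProd model n s) =Θ[atTop] fun n : ℕ => (n : ℝ) ^ (s * U.Λ) := by
  obtain ⟨c, -, hc, h⟩ := hL.exists_tendsto_diagProd_div_rpow model s
  exact (isTheta_of_div_tendsto_nhds_ne_zero h hc).symm

variable {U} in
theorem IsLargeIndex.jumpWeight_isBigO (hL : U.IsLargeIndex) (s r : ℕ) {p : ℝ}
    (hf : (fun n : ℕ => U.f model (n + 1) s r) =O[atTop] fun n : ℕ => (n : ℝ) ^ p) :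
    (fun n : ℕ => U.jumpWeight model s r (n + 1)) =O[atTop]
      fun n : ℕ => (n : ℝ) ^ (p + r * U.Λ - s * U.Λ) := by
  have h1 : (fun n : ℕ => (U.diagProd model (n + 1) s)⁻¹) =O[atTop]
      fun n : ℕ => (U.diagProd model n s)⁻¹ := by
    refine IsBigO.of_bound 1 (Eventually.of_forall fun n => ?_)
    have h2 := hL.one_le_diagProd model n s
    rw [one_mul, norm_inv, norm_inv, diagProd_succ, norm_mul,
      Real.norm_of_nonneg (zero_le_one.trans h2),
      Real.norm_of_nonneg (zero_le_one.trans (hL.one_le_f_diag model _ _))]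
    exact inv_anti₀ (by linarith) (le_mul_of_one_le_right (by linarith)
      (hL.one_le_f_diag model _ _))
  have h2 : (fun n : ℕ => (U.diagProd model n s)⁻¹) =O[atTop]
      fun n : ℕ => ((n : ℝ) ^ (s * U.Λ))⁻¹ := ((hL.diagProd_isTheta model s).inv).1
  have h3 := (hf.mul (hL.diagProd_isTheta model r).1).mul (h1.trans h2)
  refine (h3.congr' (Eventually.of_forall fun n => ?_) ?_)
  · simp only [jumpWeight, Nat.add_sub_cancel, div_eq_mul_inv]
  · filter_upwards [eventually_gt_atTop 0] with n hn
    have hn' : (0 : ℝ) < n := by exact_mod_cast hn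
    rw [Real.rpow_sub hn', Real.rpow_add hn', div_eq_mul_inv]

variable {U} in
-- The exponent of the bound is `-1 - Λ` for a jump by one level and `-(s - r)Λ` for a larger one;
-- the latter is below `-1` exactly because `Λ > 1/2`.
theorem IsLargeIndex.summable_jumpWeight (hL : U.IsLargeIndex) {s r : ℕ} (hr : r < s) :
    Summable fun n : ℕ => U.jumpWeight model s r n := by
  rw [← summable_nat_add_iff 1]
  have hΛ := hL.2.1
  obtain ⟨d, rfl⟩ := Nat.exists_eq_add_of_lt hr
  rcases d with _ | d
  · have h1 : (fun n : ℕ => U.f model (n + 1) (r + 0 + 1) r) =O[atTop]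
        fun n : ℕ => (n : ℝ) ^ (-1 : ℝ) := by
      simpa only [Real.rpow_neg_one] using U.f_isBigO_inv model r
    refine summable_of_isBigO_nat (Real.summable_nat_rpow.mpr ?_)
      (hL.jumpWeight_isBigO model (r + 0 + 1) r h1)
    push_cast
    linarith
  · have h1 : (fun n : ℕ => U.f model (n + 1) (r + (d + 1) + 1) r) =O[atTop]
        fun n : ℕ => (n : ℝ) ^ (0 : ℝ) := by
      simpa only [Real.rpow_zero] using U.f_isBigO_one model (r + (d + 1) + 1) r
    refine summable_of_isBigO_nat (Real.summable_nat_rpow.mpr ?_)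
      (hL.jumpWeight_isBigO model (r + (d + 1) + 1) r h1)
    push_cast
    have : (0 : ℝ) ≤ d := Nat.cast_nonneg d
    nlinarith

/-- A bound for the normalized weights of all jumps at time `n` from levels up to `S`. -/
noncomputable def jumpBound (S n : ℕ) : ℝ :=
  ∑ s ∈ range (S + 1), ∑ r ∈ range s, |U.jumpWeight model s r n|

theorem jumpBound_nonneg (S n : ℕ) : 0 ≤ U.jumpBound model S n :=
  sum_nonneg fun _ _ => sum_nonneg fun _ _ => abs_nonneg _

theorem abs_jumpWeight_le {S s r : ℕ} (hs : s ≤ S) (hr : r < s) (n : ℕ) :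
    |U.jumpWeight model s r n| ≤ U.jumpBound model S n :=
  (single_le_sum (f := fun r => |U.jumpWeight model s r n|) (fun _ _ => abs_nonneg _)
    (mem_range.mpr hr)).trans
  (single_le_sum (f := fun s => ∑ r ∈ range s, |U.jumpWeight model s r n|)
    (fun _ _ => sum_nonneg fun _ _ => abs_nonneg _) (mem_range.mpr (Nat.lt_succ_of_le hs)))

variable {U} in
theorem IsLargeIndex.summable_jumpBound (hL : U.IsLargeIndex) (S : ℕ) :
    Summable (U.jumpBound model S) :=
  summable_sum fun _ _ => summable_sum fun _ hr =>
    (hL.summable_jumpWeight model (mem_range.mp hr)).abs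

/-- A bound without levels and without coupling between the times, so sums over ordered times are
dominated by a power of one convergent series. The condition `d ≤ s` keeps every jump a genuine
descent, without truncation at `0`. -/
theorem abs_jumpProd_le {S s d r : ℕ} {h : Fin r → ℕ} (hs : s ≤ S) (hd : d ≤ s)
    (hh : h ∈ jumpHeights r d) (i : Fin r → ℕ) :
    |U.jumpProd model s h i| ≤ ∏ g, U.jumpBound model S (i g) := by
  induction r generalizing s d with
  | zero => simp [jumpProd]
  | succ r ih =>
    rw [mem_jumpHeights, Fin.sum_univ_succ] at hh
    have h1 := hh.1 0
    rw [← Fin.cons_self_tail h, ← Fin.cons_self_tail i, jumpProd_cons, abs_mul,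
      Fin.prod_univ_succ]
    refine mul_le_mul (U.abs_jumpWeight_le model hs (by omega) _) ?_ (abs_nonneg _)
      (U.jumpBound_nonneg model _ _)
    refine ih (d := d - h 0) (by omega) (by omega) ?_ _
    rw [mem_jumpHeights]
    exact ⟨fun ν => hh.1 ν.succ, by simp only [Fin.tail]; omega⟩

section
variable {U model}
variable {s d r q : ℕ} {h : Fin r → ℕ}

theorem IsLargeIndex.abs_limitWeight_le (hL : U.IsLargeIndex) (hd : d ≤ s)
    (hh : h ∈ jumpHeights r d) {i : Fin r → ℕ} (hi : i ∈ unboundedJumpTimes r q) :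
    |U.limitWeight model s q h i|
      ≤ (∏ g, U.jumpBound model s (i g)) * |U.sinkWeight model (s - d) q| := by
  rw [hL.limitWeight_eq model s h hi.1 hi.2, abs_mul, (mem_jumpHeights.mp hh).2]
  exact mul_le_mul_of_nonneg_right (U.abs_jumpProd_le model le_rfl hd hh i) (abs_nonneg _)

theorem IsLargeIndex.summable_prod_jumpBound (hL : U.IsLargeIndex) (s r : ℕ) :
    Summable fun i : Fin r → ℕ => ∏ g, U.jumpBound model s (i g) :=
  summable_prod_pi_of_nonneg (hL.summable_jumpBound model s) (U.jumpBound_nonneg model s) r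

/-- The inner sums over the jump times converge. -/
theorem IsLargeIndex.summable_limitWeight (hL : U.IsLargeIndex) (hd : d ≤ s)
    (hh : h ∈ jumpHeights r d) :
    Summable fun i : unboundedJumpTimes r q => U.limitWeight model s q h i.1 :=
  Summable.of_norm_bounded
    (((hL.summable_prod_jumpBound (model := model) s r).mul_right
      |U.sinkWeight model (s - d) q|).subtype (unboundedJumpTimes r q))
    fun i => hL.abs_limitWeight_le hd hh i.2

theorem mem_unboundedJumpTimes_of_mem_jumpTimes {n : ℕ} {i : Fin r → ℕ} (hi : i ∈ jumpTimes n r q) :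
    i ∈ unboundedJumpTimes r q :=
  ⟨(mem_jumpTimes.mp hi).1, (mem_jumpTimes.mp hi).2.2⟩

open Classical in
theorem IsLargeIndex.tendsto_sum_limitWeight (hL : U.IsLargeIndex) (hd : d ≤ s)
    (hh : h ∈ jumpHeights r d) :
    Tendsto (fun n => ∑ i ∈ jumpTimes n r q, U.limitWeight model s q h i) atTop
      (𝓝 (∑' i : unboundedJumpTimes r q, U.limitWeight model s q h i.1)) := by
  -- The bounded time vectors exhaust all of them: a given vector is present once `n` reaches the
  -- sum of its entries.
  have h1 : Tendsto (fun n => (jumpTimes n r q).subtype (· ∈ unboundedJumpTimes r q)) atTop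
      atTop := by
    refine tendsto_atTop_finset_of_monotone (fun a b hab i hi => ?_) fun i => ?_
    · rw [mem_subtype, mem_jumpTimes] at hi ⊢
      exact ⟨hi.1, fun g => (hi.2.1 g).trans hab, hi.2.2⟩
    · refine ⟨∑ g, i.1 g, ?_⟩
      rw [mem_subtype, mem_jumpTimes]
      exact ⟨i.2.1, fun g => single_le_sum (f := i.1) (fun _ _ => Nat.zero_le _) (mem_univ g),
        i.2.2⟩
  refine ((hL.summable_limitWeight (model := model) (q := q) hd hh).hasSum.comp h1).congr
    fun n => ?_
  exact sum_subtype_of_mem (fun i => U.limitWeight model s q h i)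
    fun i hi => mem_unboundedJumpTimes_of_mem_jumpTimes hi

/-- Uniform in `n` and summable in `q`, as dominated convergence requires. The level `s - d` before
the last jump is positive, so `jumpBound` covers that jump too. -/
theorem IsLargeIndex.sum_abs_limitWeight_le (hL : U.IsLargeIndex) (hd : d < s) (hq : q ≠ 0)
    (hh : h ∈ jumpHeights r d) (n : ℕ) :
    |∑ i ∈ jumpTimes n r q, U.limitWeight model s q h i|
      ≤ (∑' i : Fin r → ℕ, ∏ g, U.jumpBound model s (i g)) * U.jumpBound model s q := by
  have h0 := U.jumpBound_nonneg model s
  have h1 : |U.sinkWeight model (s - d) q| ≤ U.jumpBound model s q := by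
    rw [sinkWeight, if_neg hq]
    exact U.abs_jumpWeight_le model (Nat.sub_le _ _) (by omega) _
  refine (abs_sum_le_sum_abs _ _).trans ((sum_le_sum fun i hi =>
    (hL.abs_limitWeight_le hd.le hh (mem_unboundedJumpTimes_of_mem_jumpTimes hi)).trans
      (mul_le_mul_of_nonneg_left h1 (prod_nonneg fun g _ => h0 _))).trans ?_)
  rw [← sum_mul]
  exact mul_le_mul_of_nonneg_right ((hL.summable_prod_jumpBound s r).sum_le_tsum _
    fun i _ => prod_nonneg fun g _ => h0 _) (h0 q)

end

/-- The finite sums that approximate `constTerm`. -/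
noncomputable def constTermUpTo (n s q : ℕ) : ℝ :=
  ∑ l ∈ Icc 1 s, ∑ r ∈ Icc 0 (s - l), ∑ h ∈ jumpHeights r (s - l),
    ∑ i ∈ jumpTimes n r q, U.limitWeight model s q h i

/-- The constant in the bound for `constTerm`. -/
noncomputable def constTermBound (s : ℕ) : ℝ :=
  ∑ l ∈ Icc 1 s, ∑ r ∈ Icc 0 (s - l), ∑ _h ∈ jumpHeights r (s - l),
    ∑' i : Fin r → ℕ, ∏ g, U.jumpBound model s (i g)

section
variable {U}

theorem IsLargeIndex.abs_constTermUpTo_le (hL : U.IsLargeIndex) (n s : ℕ) {q : ℕ} (hq : q ≠ 0) :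
    |U.constTermUpTo model n s q| ≤ U.constTermBound model s * U.jumpBound model s q := by
  simp only [constTermUpTo, constTermBound, sum_mul]
  refine (abs_sum_le_sum_abs _ _).trans (sum_le_sum fun l hl => ?_)
  refine (abs_sum_le_sum_abs _ _).trans (sum_le_sum fun r _ => ?_)
  refine (abs_sum_le_sum_abs _ _).trans (sum_le_sum fun h hh => ?_)
  rw [mem_Icc] at hl
  exact hL.sum_abs_limitWeight_le (by omega) hq hh n

theorem IsLargeIndex.tendsto_constTermUpTo (hL : U.IsLargeIndex) (s q : ℕ) :
    Tendsto (fun n => U.constTermUpTo model n s q) atTop (𝓝 (U.constTerm model s q)) :=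
  tendsto_finsetSum _ fun _ _ => tendsto_finsetSum _ fun _ _ => tendsto_finsetSum _ fun _ hh =>
    hL.tendsto_sum_limitWeight (Nat.sub_le _ _) hh

theorem IsLargeIndex.summable_constTermBound (hL : U.IsLargeIndex) (s : ℕ) :
    Summable fun q : ℕ => U.constTermBound model s * U.jumpBound model s (q + 1) :=
  ((summable_nat_add_iff 1).mpr (hL.summable_jumpBound model s)).mul_left _

/-- The outer sum over `q` converges. -/
theorem IsLargeIndex.summable_constTerm (hL : U.IsLargeIndex) (s : ℕ) :
    Summable fun q : ℕ => U.constTerm model s (q + 1) :=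
  Summable.of_norm_bounded (hL.summable_constTermBound model s) fun q =>
    le_of_tendsto (hL.tendsto_constTermUpTo model s (q + 1)).norm
      (Eventually.of_forall fun n => hL.abs_constTermUpTo_le model n s q.succ_ne_zero)

/-- Here `n` bounds both the outer sum over `q` and the inner times. The outer sum is extended by
zeros, and dominated convergence for series handles both limits at once. -/
theorem IsLargeIndex.tendsto_phi_div_zero (hL : U.IsLargeIndex) {s : ℕ} (hs : 1 ≤ s) :
    Tendsto (fun n => U.phi model n s 0 / U.diagProd model n s) atTop
      (𝓝 (∑' q : ℕ, U.constTerm model s (q + 1))) := by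
  have h1 : ∀ n, U.phi model n s 0 / U.diagProd model n s
      = ∑' q : ℕ, if q < n then U.constTermUpTo model n s (q + 1) else 0 := by
    intro n
    have hd := hL.diagProd_ne_zero model n s
    rw [tsum_eq_sum (s := range n) fun q hq => if_neg (by simpa using hq),
      sum_congr rfl fun q hq => if_pos (mem_range.mp hq), range_eq_Ico,
      sum_Ico_add' (fun q => U.constTermUpTo model n s q) 0 n 1, phi, if_neg (by omega),
      if_pos rfl, sum_div]
    refine sum_congr rfl fun q hq => ?_
    simp only [constTermUpTo, sum_div]
    refine sum_congr rfl fun l _ => sum_congr rfl fun r _ => sum_congr rfl fun h _ =>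
      sum_congr rfl fun i hi => ?_
    rw [mem_jumpTimes] at hi
    rw [hL.pathWeight_eq_limitWeight model s h hi.1 hi.2.1 hi.2.2 (mem_Icc.mp hq).2,
      mul_div_cancel_left₀ _ hd]
  simp only [h1]
  refine tendsto_tsum_of_dominated_convergence (hL.summable_constTermBound model s) (fun q => ?_)
    (Eventually.of_forall fun n q => ?_)
  · refine (hL.tendsto_constTermUpTo model s (q + 1)).congr' ?_
    filter_upwards [eventually_gt_atTop q] with n hn
    rw [if_pos hn]
  · have h2 := hL.abs_constTermUpTo_le model n s q.succ_ne_zero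
    split_ifs
    · exact h2
    · rw [norm_zero]; exact (abs_nonneg _).trans h2

/-- The normalized coefficients converge. -/
theorem IsLargeIndex.tendsto_phi_div (hL : U.IsLargeIndex) {s k : ℕ} (hk : k ≤ s) :
    Tendsto (fun n => U.phi model n s k / U.diagProd model n s) atTop
      (𝓝 (U.phiTilde model s k)) := by
  rw [phiTilde]
  rcases hk.eq_or_lt with rfl | hks
  · rw [if_pos rfl]
    refine tendsto_const_nhds.congr fun n => ?_
    rw [phi, if_pos rfl]
    exact (div_self (hL.diagProd_ne_zero model n k)).symm
  rw [if_neg hks.ne]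
  rcases Nat.eq_zero_or_pos k with rfl | hk0
  · rw [if_pos rfl]
    exact hL.tendsto_phi_div_zero model hks
  · rw [if_neg hk0.ne']
    have h1 := fun (r : ℕ) (_ : r ∈ Icc 1 (s - k)) => tendsto_finsetSum (jumpHeights r (s - k))
      fun h hh => hL.tendsto_sum_limitWeight (model := model) (q := 0) (Nat.sub_le s k) hh
    refine (tendsto_finsetSum (Icc 1 (s - k)) h1).congr fun n => ?_
    have hd := hL.diagProd_ne_zero model n s
    rw [phi, if_neg hks.ne, if_neg hk0.ne']
    simp only [sum_div]
    refine sum_congr rfl fun r _ => sum_congr rfl fun h _ => sum_congr rfl fun i hi => ?_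
    rw [mem_jumpTimes] at hi
    rw [hL.pathWeight_eq_limitWeight model s h hi.1 hi.2.1 hi.2.2 (Nat.zero_le _),
      mul_div_cancel_left₀ _ hd]

end

end UrnScheme

/-! ### The main theorem -/

theorem mainTheorem4 (model : SamplingModel) (U : UrnScheme) (hA : U.IsAffine model)
    (hL : U.IsLargeIndex) {Ω : Type*} [MeasurableSpace Ω] (μ : Measure Ω) [IsProbabilityMeasure μ]
    (X W B : ℕ → Ω → ℕ) (hP : U.IsEvolution model μ X W B) (s : ℕ) (hs : 1 ≤ s) :
    -- the moments of the shifted variables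
    (∀ n : ℕ, Integrable (fun ω => U.shifted W n ω ^ s) μ ∧
      ∫ ω, U.shifted W n ω ^ s ∂μ
        = ∑ k ∈ Icc 0 s, U.phi model n s k * (U.W₀ : ℝ) ^ k) ∧
    -- convergence of the nested infinite sums
    (∀ k, 1 ≤ k → k < s → ∀ r ∈ Icc 1 (s - k), ∀ h ∈ UrnScheme.jumpHeights r (s - k),
      Summable (fun i : UrnScheme.unboundedJumpTimes r 0 => U.limitWeight model s 0 h i.1)) ∧
    (∀ q, 1 ≤ q → ∀ l ∈ Icc 1 s, ∀ r ∈ Icc 0 (s - l), ∀ h ∈ UrnScheme.jumpHeights r (s - l),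
      Summable (fun i : UrnScheme.unboundedJumpTimes r q => U.limitWeight model s q h i.1)) ∧
    Summable (fun q : ℕ => U.constTerm model s (q + 1)) ∧
    -- these sums are the limits of the normalized coefficients
    (∀ k ≤ s, Tendsto (fun n : ℕ => U.phi model n s k / U.phi model n s s) atTop
      (𝓝 (U.phiTilde model s k))) ∧
    -- the limits of the normalized moments
    (∃ E : ℝ,
      Tendsto (fun n : ℕ => ∫ ω, (U.shifted W n ω / (n : ℝ) ^ U.Λ) ^ s ∂μ) atTop (𝓝 E) ∧
      (E : ℂ) = U.gammaFactor model s *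
        ∑ k ∈ Icc 0 s, (U.phiTilde model s k : ℂ) * (U.W₀ : ℂ) ^ k) := by
  have hIcc : Icc 0 s = range (s + 1) := by ext; simp
  have hdiag : ∀ n, U.phi model n s s = U.diagProd model n s := fun n => by
    rw [UrnScheme.phi, if_pos rfl]; rfl
  refine ⟨fun n => ⟨hP.integrable_shifted_pow n s, ?_⟩, fun k _ _ r _ h hh =>
    hL.summable_limitWeight (Nat.sub_le _ _) hh, fun q _ l _ r _ h hh =>
    hL.summable_limitWeight (Nat.sub_le _ _) hh, hL.summable_constTerm model s, fun k hk => ?_, ?_⟩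
  · rw [hP.integral_shifted_pow hA hL, hIcc, mul_sum]
    refine sum_congr rfl fun k _ => ?_
    have := hL.diagProd_ne_zero model n s
    field_simp
  · simp only [hdiag]
    exact hL.tendsto_phi_div model hk
  · obtain ⟨c, hc, -, hlim⟩ := hL.exists_tendsto_diagProd_div_rpow model s
    -- The normalized moment is `D_{n,s} / n^{sΛ}`, with limit `c`, times a finite sum of normalized
    -- coefficients that converges termwise.
    refine ⟨c * ∑ k ∈ range (s + 1), U.phiTilde model s k * (U.W₀ : ℝ) ^ k, ?_, ?_⟩
    · have h1 : Tendsto (fun n => ∑ k ∈ range (s + 1), U.phi model n s k / U.diagProd model n s *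
          (U.W₀ : ℝ) ^ k) atTop
          (𝓝 (∑ k ∈ range (s + 1), U.phiTilde model s k * (U.W₀ : ℝ) ^ k)) :=
        tendsto_finsetSum _ fun k hk =>
          (hL.tendsto_phi_div model (Nat.lt_succ_iff.mp (mem_range.mp hk))).mul_const _
      refine (hlim.mul h1).congr fun n => ?_
      simp only [div_pow]
      rw [integral_div, hP.integral_shifted_pow hA hL, mul_comm (s : ℝ) U.Λ,
        Real.rpow_mul (Nat.cast_nonneg n), Real.rpow_natCast]
      ring
    · rw [hIcc]
      push_cast
      rw [hc]
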